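/- Let $H$ be a separable real Hilbert space. Let $C_b(H)$ be the Banach space of bounded uniformly continuous functions $H\to\mathbb R$ with the supremum norm $\|\cdot\|$, and let $C_b^1(H)$ be the space of all $f\in C_b(H)$ that are Fréchet differentiable with bounded and uniformly continuous differential $Df:H\to H^*\cong H$; put $\|Df\|_0=\sup_{x\in H}|Df(x)|$. Assume: (i) $A:D(A)\subset H\to H$ generates a strongly continuous semigroup $(e^{tA})_{t\ge0}$ with $\|e^{tA}\|\le e^{\omega t}$ for all $t\ge 0$, for some $\omega\in\mathbb R$; (ii) $Q\in\mathcal L(H)$ is self-adjoint and positive ($\langle Qx,x\rangle\ge0$ for all $x$); (iii) for every $t>0$ the operator $Q_tx=\int_0^te^{sA}Qe^{sA^*}x\,ds$ is of trace class; (iv) $F:H\to H$ is Fréchet differentiable with bounded and uniformly continuous differential, and $K=\sup_{x\in H}\|DF(x)\|_{\mathcal L(H)}$. Let $R_t\varphi(x)=\int_H\varphi(e^{tA}x+y)\,N_{Q_t}(dy)$ be the Ornstein–Uhlenbeck semigroup, where $N_{Q_t}$ is the Gaussian measure of mean $0$ and covariance $Q_t$. Let $L$ be its infinitesimal generator: $\varphi\in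 D(L)$ and $L\varphi=g$ if and only if $\varphi,g\in C_b(H)$, $\lim_{t\to0^+}(R_t\varphi(x)-\varphi(x))/t=g(x)$ for every $x\in H$, and $\sup_{t\in(0,1)}\|(R_t\varphi-\varphi)/t\|<\infty$. Let $\eta(\cdot,x)$ be the solution of $\frac{d}{dt}\eta(t,x)=F(\eta(t,x))$, $t\ge 0$, $\eta(0,x)=x$. For $\varepsilon>0$ and $\varphi\in C_b(H)$ put $\mathcal F_\varepsilon\varphi(x)=\frac1\varepsilon\big(\varphi(\eta(\varepsilon,x))-\varphi(x)\big)$, and let $N_\varepsilon\varphi=L\varphi+\mathcal F_\varepsilon\varphi$ with domain $D(N_\varepsilon)=D(L)\cap C_b^1(H)$. **Proposition 3.7.** Let $\varepsilon>0$. The operator $N_\varepsilon$ is essentially m-dissipative in $C_b(H)$: it is dissipative ($\|\lambda\varphi-N_\varepsilon\varphi\|\ge\lambda\|\varphi\|$ for all $\lambda>0$ and $\varphi\in D(N_\varepsilon)$) and closable, and its closure $\overline{N}_\varepsilon$, which is the operator $L+\mathcal F_\varepsilon$ with domain $D(L)$, is dissipative and satisfies $(\lambda-\overline{N}_\varepsilon)(D(L))=C_b(H)$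 for every $\lambda>0$. Moreover, let $\lambda>0$ with $\lambda>\omega+\frac{e^{\varepsilon K}-1}{\varepsilon}$. Then the bounded resolvent $R(\lambda+\frac1\varepsilon,L)=(\lambda+\frac1\varepsilon-L)^{-1}$ exists on $C_b(H)$; with $T_\lambda\psi=R\big(\lambda+\tfrac1\varepsilon,L\big)\big[\tfrac1\varepsilon\psi(\eta(\varepsilon,\cdot))\big]$, $\psi\in C_b(H)$, the operator $1-T_\lambda$ is invertible in $\mathcal L(C_b(H))$, and the resolvent $R(\lambda,N_\varepsilon):=(\lambda-\overline{N}_\varepsilon)^{-1}$ exists and is given by $$R(\lambda,N_\varepsilon)=(1-T_\lambda)^{-1}R\Big(\lambda+\frac1\varepsilon,L\Big).$$ It maps $C_b^1(H)$ into $D(L)\cap C_b^1(H)$, so that $\varphi=R(\lambda,N_\varepsilon)f$ satisfies $\varphi\in D(N_\varepsilon)$ and $\lambda\varphi-N_\varepsilon\varphi=f$ for $f\in C_b^1(H)$, and for every $f\in C_b^1(H)$ $$\|DR(\lambda,N_\varepsilon)f\|_0\le\frac{1}{\lambda-\omega-\frac{e^{K\varepsilon}-1}{\varepsilon}}\,\|Df\|_0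 .$$ -/

import Mathlib

open MeasureTheory Filter Topology Set
open scoped BoundedContinuousFunction

set_option linter.unusedSectionVars false

noncomputable section

namespace OUPert

/-! ### Unbounded operators: dissipativity and resolvents -/

section Operators

variable {X : Type*} [NormedAddCommGroup X] [NormedSpace ℝ X]

/-- The operator `N : D(N) ⊆ X → X` is dissipative. -/
def IsDissipative (N : X →ₗ.[ℝ] X) : Prop :=
  ∀ l : ℝ, 0 < l → ∀ φ : N.domain, l * ‖(φ : X)‖ ≤ ‖l • (φ : X) - N φ‖

/-- The operator `N` is dissipative and `l - N : D(N) → X` is onto for every `l > 0`. -/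
def IsMDissipative (N : X →ₗ.[ℝ] X) : Prop :=
  IsDissipative N ∧ ∀ l : ℝ, 0 < l → ∀ f : X, ∃ φ : N.domain, l • (φ : X) - N φ = f

/-- The bounded operator `R` is the resolvent `(l - N)⁻¹`, that is, the two-sided inverse of
`l - N : D(N) → X`. -/
def IsResolvent (N : X →ₗ.[ℝ] X) (l : ℝ) (R : X →L[ℝ] X) : Prop :=
  (∀ f : X, ∃ h : R f ∈ N.domain, l • R f - N ⟨R f, h⟩ = f) ∧
    ∀ φ : N.domain, R (l • (φ : X) - N φ) = φ

end Operators

variable {H : Type*} [NormedAddCommGroup H] [InnerProductSpace ℝ H]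

/-! ### Function spaces -/

/-- The subspace of uniformly continuous functions in the space of bounded continuous functions
`H → ℝ`. -/
def CbSub (H : Type*) [NormedAddCommGroup H] : Submodule ℝ (H →ᵇ ℝ) where
  carrier := {φ | UniformContinuous φ}
  zero_mem' := uniformContinuous_const
  add_mem' := fun h₁ h₂ => h₁.add h₂
  smul_mem' := fun c _ h => h.const_smul c

/-- `C_b(H)`: bounded uniformly continuous functions `H → ℝ`, with the supremum norm
(inherited from Mathlib's space of bounded continuous functions). -/
def Cb (H : Type*) [NormedAddCommGroup H] : Type _ := CbSub H

instance : NormedAddCommGroup (Cb H) := inferInstanceAs (NormedAddCommGroup (CbSub H))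

instance : NormedSpace ℝ (Cb H) := inferInstanceAs (NormedSpace ℝ (CbSub H))

instance : CoeFun (Cb H) (fun _ => H → ℝ) := ⟨fun φ => φ.1⟩

lemma Cb.uniformContinuous (φ : Cb H) : UniformContinuous φ := φ.2

lemma Cb.ext {φ ψ : Cb H} (h : ∀ x, φ x = ψ x) : φ = ψ :=
  Subtype.ext (BoundedContinuousFunction.ext h)

lemma Cb.zero_apply (x : H) : (0 : Cb H) x = 0 := rfl

lemma Cb.add_apply (φ ψ : Cb H) (x : H) : (φ + ψ) x = φ x + ψ x := rfl

lemma Cb.smul_apply (c : ℝ) (φ : Cb H) (x : H) : (c • φ) x = c * φ x := rfl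

lemma Cb.abs_le_norm (φ : Cb H) (x : H) : |φ x| ≤ ‖φ‖ :=
  BoundedContinuousFunction.norm_coe_le_norm φ.1 x

lemma Cb.norm_le {φ : Cb H} {C : ℝ} (hC : 0 ≤ C) (h : ∀ x, |φ x| ≤ C) : ‖φ‖ ≤ C :=
  (BoundedContinuousFunction.norm_le (f := φ.1) hC).2 h

/-- `C_b^1(H)` as a subspace of `C_b(H)`: Fréchet differentiable functions whose differential is
bounded and uniformly continuous. -/
def Cb1 (H : Type*) [NormedAddCommGroup H] [InnerProductSpace ℝ H] : Submodule ℝ (Cb H) where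
  carrier := {φ | Differentiable ℝ φ ∧ UniformContinuous (fderiv ℝ φ) ∧
    ∃ C : ℝ, ∀ x, ‖fderiv ℝ φ x‖ ≤ C}
  zero_mem' := by
    have h : fderiv ℝ ((0 : Cb H) : H → ℝ) = fun _ => 0 := by
      funext x
      exact fderiv_const_apply (0 : ℝ)
    refine ⟨differentiable_const (0 : ℝ), ?_, 0, fun x => ?_⟩
    · rw [h]; exact uniformContinuous_const
    · rw [h]; simp
  add_mem' := by
    rintro φ ψ ⟨h₁, h₂, C₁, h₃⟩ ⟨k₁, k₂, C₂, k₃⟩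
    have h : fderiv ℝ ((φ + ψ : Cb H) : H → ℝ) = fun x => fderiv ℝ φ x + fderiv ℝ ψ x := by
      funext x
      exact fderiv_add (h₁ x) (k₁ x)
    refine ⟨h₁.add k₁, ?_, C₁ + C₂, fun x => ?_⟩
    · rw [h]; exact h₂.add k₂
    · rw [h]; exact (norm_add_le _ _).trans (add_le_add (h₃ x) (k₃ x))
  smul_mem' := by
    rintro c φ ⟨h₁, h₂, C₁, h₃⟩
    have h : fderiv ℝ ((c • φ : Cb H) : H → ℝ) = fun x => c • fderiv ℝ φ x := by
      funext x
      exact fderiv_const_smul (h₁ x) c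
    refine ⟨h₁.const_smul c, ?_, ‖c‖ * C₁, fun x => ?_⟩
    · rw [h]; exact h₂.const_smul c
    · rw [h, norm_smul]; exact mul_le_mul_of_nonneg_left (h₃ x) (norm_nonneg c)

/-- The seminorm `‖Dφ‖₀ = sup_x |Dφ(x)|`, meant for `φ ∈ C_b^1(H)`
(`H` and its dual are identified isometrically). -/
def gradNorm (φ : Cb H) : ℝ := ⨆ x : H, ‖fderiv ℝ φ x‖

/-- `C_b^1(H; H)`: Fréchet differentiable vector fields with bounded and uniformly continuous
differential. -/
def IsCb1Field (F : H → H) : Prop :=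
  Differentiable ℝ F ∧ UniformContinuous (fderiv ℝ F) ∧ ∃ C : ℝ, ∀ x, ‖fderiv ℝ F x‖ ≤ C

/-! ### Strongly continuous semigroups and trace class operators -/

/-- `(S t)_{t ≥ 0}` is a strongly continuous semigroup (values at `t < 0` are irrelevant). -/
structure IsC0Semigroup (S : ℝ → H →L[ℝ] H) : Prop where
  zero : S 0 = ContinuousLinearMap.id ℝ H
  add : ∀ s t : ℝ, 0 ≤ s → 0 ≤ t → S (s + t) = (S s).comp (S t)
  tendsto : ∀ x : H, Tendsto (fun t => S t x) (𝓝[>] 0) (𝓝 x)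

/-- `A : D(A) ⊆ H → H` is the infinitesimal generator of `S`. -/
def IsGenerator (A : H →ₗ.[ℝ] H) (S : ℝ → H →L[ℝ] H) : Prop :=
  ∀ x y : H, (x, y) ∈ A.graph ↔ Tendsto (fun t : ℝ => t⁻¹ • (S t x - x)) (𝓝[>] 0) (𝓝 y)

/-- `T` is a trace class (nuclear) operator on `H`: `T x = ∑ₙ ⟨aₙ, x⟩ bₙ` with
`∑ₙ |aₙ| |bₙ| < ∞`. Linearity and boundedness of `T` follow. -/
def IsTraceClass (T : H → H) : Prop :=
  ∃ a b : ℕ → H, Summable (fun n => ‖a n‖ * ‖b n‖) ∧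
    ∀ x : H, HasSum (fun n => inner ℝ (a n) x • b n) (T x)

/-- `Q_t x = ∫₀ᵗ e^{sA} Q e^{sA*} x ds`, where `S s = e^{sA}`. -/
def covOp [CompleteSpace H] (S : ℝ → H →L[ℝ] H) (Q : H →L[ℝ] H) (t : ℝ) (x : H) : H :=
  ∫ s in (0 : ℝ)..t, S s (Q (ContinuousLinearMap.adjoint (S s) x))

/-! ### Gaussian measures and the Ornstein-Uhlenbeck semigroup -/

section Gaussian

variable [MeasurableSpace H]

/-- `μ` is the Gaussian measure on `H` of mean `0` and covariance operator `T`: its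
characteristic function is `ξ ↦ exp (-⟨T ξ, ξ⟩ / 2)`. -/
def IsCenteredGaussian (T : H → H) (μ : Measure H) : Prop :=
  IsProbabilityMeasure μ ∧
    ∀ ξ : H, charFun μ ξ = Complex.exp (-((inner ℝ (T ξ) ξ : ℝ) : ℂ) / 2)

open Classical in
/-- The Gaussian measure `N_T` of mean `0` and covariance operator `T`. It exists (and is unique)
for positive self-adjoint trace class `T` on a separable Hilbert space, which is the only case of
interest; the value is `0` if there is no such measure. -/
def gaussian (T : H → H) : Measure H :=
  if h : ∃ μ : Measure H, IsCenteredGaussian T μ then h.choose else 0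

instance (T : H → H) : IsFiniteMeasure (gaussian T) := by
  unfold gaussian
  split_ifs with h
  · have := h.choose_spec.1
    infer_instance
  · infer_instance

variable [CompleteSpace H]

/-- The Ornstein-Uhlenbeck semigroup `R_t φ(x) = ∫ φ(e^{tA} x + y) N_{Q_t}(dy)`. -/
def ouSemigroup (S : ℝ → H →L[ℝ] H) (Q : H →L[ℝ] H) (t : ℝ) (φ : Cb H) (x : H) : ℝ :=
  ∫ y, φ (S t x + y) ∂(gaussian (covOp S Q t))

/-- `φ ∈ D(L)` and `L φ = g`: the difference quotients `(R_t φ - φ) / t` converge pointwise to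
`g ∈ C_b(H)` as `t → 0⁺`, and are uniformly bounded for `t ∈ (0,1)`. -/
def IsOUGen (S : ℝ → H →L[ℝ] H) (Q : H →L[ℝ] H) (φ g : Cb H) : Prop :=
  (∀ x : H, Tendsto (fun t : ℝ => (ouSemigroup S Q t φ x - φ x) / t) (𝓝[>] 0)
      (𝓝 (g x))) ∧
    ∃ C : ℝ, ∀ t ∈ Ioo (0 : ℝ) 1, ∀ x : H,
      |(ouSemigroup S Q t φ x - φ x) / t| ≤ C

variable [BorelSpace H]

lemma integrable_shift (φ : Cb H) (z : H) (T : H → H) :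
    Integrable (fun y => φ (z + y)) (gaussian T) :=
  (φ.1.compContinuous ⟨fun y => z + y, by fun_prop⟩).integrable (gaussian T)

lemma ouSemigroup_add (S : ℝ → H →L[ℝ] H) (Q : H →L[ℝ] H) (t : ℝ) (φ ψ : Cb H) (x : H) :
    ouSemigroup S Q t (φ + ψ) x = ouSemigroup S Q t φ x + ouSemigroup S Q t ψ x :=
  integral_add (integrable_shift φ _ _) (integrable_shift ψ _ _)

lemma ouSemigroup_smul (S : ℝ → H →L[ℝ] H) (Q : H →L[ℝ] H) (t : ℝ) (c : ℝ) (φ : Cb H)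
    (x : H) : ouSemigroup S Q t (c • φ) x = c * ouSemigroup S Q t φ x :=
  integral_const_mul c _

lemma IsOUGen.add {S : ℝ → H →L[ℝ] H} {Q : H →L[ℝ] H} {φ g ψ k : Cb H}
    (h₁ : IsOUGen S Q φ g) (h₂ : IsOUGen S Q ψ k) : IsOUGen S Q (φ + ψ) (g + k) := by
  obtain ⟨h₁, C₁, hC₁⟩ := h₁
  obtain ⟨h₂, C₂, hC₂⟩ := h₂
  have key : ∀ t x, (ouSemigroup S Q t (φ + ψ) x - (φ + ψ) x) / t =
      (ouSemigroup S Q t φ x - φ x) / t +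
        (ouSemigroup S Q t ψ x - ψ x) / t := by
    intro t x
    rw [ouSemigroup_add]
    rw [Cb.add_apply]
    ring
  refine ⟨fun x => ?_, C₁ + C₂, fun t ht x => ?_⟩
  · simp only [key]
    exact (h₁ x).add (h₂ x)
  · rw [key]
    exact (abs_add_le _ _).trans (add_le_add (hC₁ t ht x) (hC₂ t ht x))

lemma IsOUGen.smul {S : ℝ → H →L[ℝ] H} {Q : H →L[ℝ] H} {φ g : Cb H} (c : ℝ)
    (h₁ : IsOUGen S Q φ g) : IsOUGen S Q (c • φ) (c • g) := by
  obtain ⟨h₁, C₁, hC₁⟩ := h₁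
  have key : ∀ t x, (ouSemigroup S Q t (c • φ) x - (c • φ) x) / t =
      c * ((ouSemigroup S Q t φ x - φ x) / t) := by
    intro t x
    rw [ouSemigroup_smul]
    rw [Cb.smul_apply]
    ring
  refine ⟨fun x => ?_, |c| * C₁, fun t ht x => ?_⟩
  · simp only [key]
    exact (h₁ x).const_mul c
  · rw [key, abs_mul]
    exact mul_le_mul_of_nonneg_left (hC₁ t ht x) (abs_nonneg c)

lemma IsOUGen.zero (S : ℝ → H →L[ℝ] H) (Q : H →L[ℝ] H) : IsOUGen S Q 0 0 := by
  have key : ∀ t x, (ouSemigroup S Q t 0 x - (0 : Cb H) x) / t = 0 := by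
    intro t x
    simp [ouSemigroup, Cb.zero_apply]
  refine ⟨fun x => ?_, 0, fun t _ x => ?_⟩
  · simp only [key]
    exact tendsto_const_nhds
  · rw [key, abs_zero]

lemma IsOUGen.unique {S : ℝ → H →L[ℝ] H} {Q : H →L[ℝ] H} {φ g k : Cb H}
    (h₁ : IsOUGen S Q φ g) (h₂ : IsOUGen S Q φ k) : g = k :=
  Cb.ext fun x => tendsto_nhds_unique (h₁.1 x) (h₂.1 x)

/-- The Ornstein-Uhlenbeck operator `(L, D(L))` in `C_b(H)`: `φ ∈ D(L)` if and only if
`IsOUGen S Q φ g` for some `g`, and then `L φ` is this (unique) `g`. -/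
def ouOp (S : ℝ → H →L[ℝ] H) (Q : H →L[ℝ] H) : Cb H →ₗ.[ℝ] Cb H where
  domain :=
    { carrier := {φ | ∃ g : Cb H, IsOUGen S Q φ g}
      zero_mem' := ⟨0, IsOUGen.zero S Q⟩
      add_mem' := fun ⟨g, hg⟩ ⟨k, hk⟩ => ⟨g + k, hg.add hk⟩
      smul_mem' := fun c _ ⟨g, hg⟩ => ⟨c • g, hg.smul c⟩ }
  toFun :=
    { toFun := fun φ => φ.2.choose
      map_add' := fun φ ψ =>
        IsOUGen.unique (φ + ψ).2.choose_spec (φ.2.choose_spec.add ψ.2.choose_spec)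
      map_smul' := fun c φ =>
        IsOUGen.unique (c • φ).2.choose_spec (φ.2.choose_spec.smul c) }

end Gaussian

/-! ### The flow of `F` and the approximating operators -/

open Classical in
/-- `flow F t x` is `η(t, x)`, where `η(·, x)` is the solution on `[0, ∞)` of `η' = F(η)`,
`η(0) = x`. For `F ∈ C_b^1(H; H)` the solution exists and is unique. -/
def flow (F : H → H) (t : ℝ) (x : H) : H :=
  if h : ∃ u : ℝ → H, u 0 = x ∧ ∀ s : ℝ, 0 ≤ s → HasDerivWithinAt u (F (u s)) (Ici 0) s
  then h.choose t else x

/-- The composition operator `φ ↦ φ ∘ g` as a linear map. -/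
def compLin (g : H → H) (hg : UniformContinuous g) : Cb H →ₗ[ℝ] Cb H where
  toFun φ := ⟨φ.1.compContinuous ⟨g, hg.continuous⟩, UniformContinuous.comp φ.2 hg⟩
  map_add' _ _ := rfl
  map_smul' _ _ := rfl

open Classical in
/-- The composition operator `φ ↦ φ ∘ g` in `C_b(H)`, for a uniformly continuous `g : H → H`.
(It is used only for `g = η(ε, ·)`, `ε > 0`, which is Lipschitz continuous; the value for other
`g` is irrelevant.) -/
def compOp (g : H → H) : Cb H →L[ℝ] Cb H :=
  if hg : UniformContinuous g then
    (compLin g hg).mkContinuous 1 fun φ => by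
      rw [one_mul]
      exact Cb.norm_le (norm_nonneg φ) fun x => φ.abs_le_norm (g x)
  else 0

lemma compOp_apply {g : H → H} (hg : UniformContinuous g) (φ : Cb H) (x : H) :
    compOp g φ x = φ (g x) := by
  unfold compOp
  rw [dif_pos hg]
  rfl

/-- `F_ε φ = (φ(η(ε, ·)) - φ) / ε`. -/
def approxF (F : H → H) (ε : ℝ) : Cb H →L[ℝ] Cb H :=
  ε⁻¹ • (compOp (flow F ε) - ContinuousLinearMap.id ℝ (Cb H))

section Approx

variable [MeasurableSpace H] [CompleteSpace H] [BorelSpace H]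

/-- The operator `φ ↦ L φ + F_ε φ` with domain `D(L)`. -/
def pertOp (S : ℝ → H →L[ℝ] H) (Q : H →L[ℝ] H) (F : H → H) (ε : ℝ) : Cb H →ₗ.[ℝ] Cb H where
  domain := (ouOp S Q).domain
  toFun := (ouOp S Q).toFun + (approxF F ε : Cb H →ₗ[ℝ] Cb H).comp (ouOp S Q).domain.subtype

/-- The approximating operator `N_ε φ = L φ + F_ε φ` with domain `D(L) ∩ C_b^1(H)`. -/
def approxOp (S : ℝ → H →L[ℝ] H) (Q : H →L[ℝ] H) (F : H → H) (ε : ℝ) :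
    Cb H →ₗ.[ℝ] Cb H :=
  (pertOp S Q F ε).domRestrict (Cb1 H)

/-- `T_l ψ = R (ψ(η(ε, ·)) / ε)`, to be used with `R = R(l + 1/ε, L)`. -/
def opT (F : H → H) (ε : ℝ) (R : Cb H →L[ℝ] Cb H) : Cb H →L[ℝ] Cb H :=
  R.comp (ε⁻¹ • compOp (flow F ε))

end Approx

end OUPert

end

/-!
The Ornstein-Uhlenbeck operator `L` has resolvent `R(l, L) φ = ∫₀^∞ e^{-lt} R_t φ dt`, of norm at
most `1/l`. Writing `C φ = φ(η(ε, ·))`, a contraction of `C_b(H)`, one has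
`l - (L + F_ε) = (l + 1/ε - L) - C/ε`, so `L + F_ε` on `D(L)` is m-dissipative with resolvent
`(1 - T_l)⁻¹ R(l + 1/ε, L)`, where `T_l = R(l + 1/ε, L) C/ε` has norm less than `1`
(`IsResolvent.perturb`, `IsResolvent.dissipative_perturb`). On `C_b^1(H)`, `C` multiplies `‖D·‖₀` by
at most `e^{Kε}`, and `R(l, L)` by at most `1/(l - ω)` if `l > ω`. Hence for
`l > ω + (e^{Kε} - 1)/ε` the Neumann series of `(1 - T_l)⁻¹` converges in `C_b^1(H)`, which gives
the gradient estimate (`OUSetting.pertResolvent_mem_Cb1`). So the resolvent leaves the dense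
subspace `C_b^1(H)` invariant, and `D(L) ∩ C_b^1(H)` is a core of `L + F_ε`
(`IsResolvent.closure_domRestrict`).

The function spaces are handled without differentiating under integrals or along flows: a bounded
uniformly continuous function is in `C_b^1(H)` if and only if its increments `g(· + k) - g` have
Lipschitz constants tending to `0` as `k → 0` (`mem_Cb1_iff`), and then `‖Dg‖₀` is its Lipschitz
constant. Such bounds pass to Gaussian averages, Laplace transforms, compositions with the flow (by
Gronwall's inequality) and series. Density of `C_b^1(H)` follows from Lasry-Lions regularization
(`exists_mem_Cb1_norm_sub_le`).

For the Gaussian part, a Gaussian measure with a given positive trace class covariance is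
constructed from a sequence of independent real Gaussian variables (`exists_isCenteredGaussian`);
characteristic functions give its uniqueness, and with it the semigroup law for `R_t`. The generator
is defined by pointwise limits, so that `R(l, L)` is identified as the inverse of `l - L` from right
derivatives in time of `R_t φ(x)` (`OUSetting.isOUGen_resolvent`, `OUSetting.resolvent_of_isOUGen`).
-/

noncomputable section

namespace OUPert

variable {H : Type*} [NormedAddCommGroup H] [InnerProductSpace ℝ H]

/-! ### Functions with uniformly small mixed differences -/

/-- The increments `g (· + k) - g` have Lipschitz constants tending to `0` as `k → 0`. For bounded
uniformly continuous `g : H → ℝ` this describes `C_b^1(H)` without mentioning derivatives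
(`mem_Cb1_iff`), in a form that passes to integrals, compositions and limits. -/
def HasUnifIncr {E : Type*} [NormedAddCommGroup E] (g : H → E) : Prop :=
  ∀ δ > 0, ∃ r > 0, ∀ x h k, ‖k‖ ≤ r →
    ‖g (x + h + k) - g (x + h) - g (x + k) + g x‖ ≤ δ * ‖h‖

lemma HasUnifIncr.of_fderiv {E : Type*} [NormedAddCommGroup E] [NormedSpace ℝ E] {g : H → E}
    (hg : Differentiable ℝ g) (hu : UniformContinuous (fderiv ℝ g)) : HasUnifIncr g := by
  intro δ hδ
  obtain ⟨r, hr, H1⟩ := Metric.uniformContinuous_iff.1 hu δ hδ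
  refine ⟨r / 2, by positivity, fun x h k hk => ?_⟩
  have hd : ∀ y, HasFDerivAt (fun y => g (y + k) - g y) (fderiv ℝ g (y + k) - fderiv ℝ g y) y := by
    intro y
    exact ((hasFDerivAt_comp_add_right k).2 (hg (y + k)).hasFDerivAt).sub (hg y).hasFDerivAt
  have := Convex.norm_image_sub_le_of_norm_hasFDerivWithin_le (s := univ) (x := x) (y := x + h)
    (C := δ) (fun y _ => (hd y).hasFDerivWithinAt) (fun y _ => ?_) convex_univ (mem_univ _)
    (mem_univ _)
  · simp only [add_sub_cancel_left] at this
    convert this using 2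
    abel
  · rw [← dist_eq_norm]
    refine (H1 ?_).le
    rw [dist_eq_norm, add_sub_cancel_left]
    linarith

/-- For small increments, `g (x + m v) - g x` is almost `m (g (x + v) - g x)`. -/
lemma HasUnifIncr.nsmul_sub_le {g : H → ℝ} {δ r : ℝ}
    (hg : ∀ x h k, ‖k‖ ≤ r → ‖g (x + h + k) - g (x + h) - g (x + k) + g x‖ ≤ δ * ‖h‖)
    (x v : H) (m : ℕ) (hm : m * ‖v‖ ≤ r) :
    |(m : ℝ) * (g (x + v) - g x) - (g (x + (m : ℝ) • v) - g x)| ≤ m * (δ * ‖v‖) := by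
  induction m with
  | zero => simp
  | succ m ih =>
    push_cast at hm ⊢
    have hm' : m * ‖v‖ ≤ r := by nlinarith [norm_nonneg v]
    have h1 := ih hm'
    have h2 := hg x v ((m : ℝ) • v) (by rwa [norm_smul, Real.norm_natCast])
    have e : x + ((m : ℝ) + 1) • v = x + v + (m : ℝ) • v := by rw [add_smul, one_smul]; abel
    rw [Real.norm_eq_abs] at h2
    rw [e]
    calc _ = |((m : ℝ) * (g (x + v) - g x) - (g (x + (m : ℝ) • v) - g x)) -
          (g (x + v + (m : ℝ) • v) - g (x + v) - g (x + (m : ℝ) • v) + g x)| := by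
            congr 1; ring
      _ ≤ _ := (abs_sub _ _).trans (by linarith)

/-- A continuous function whose increments have small Lipschitz constants is uniformly Fréchet
differentiable, with uniformly continuous derivative: the dyadic difference quotients form Cauchy
sequences, and small mixed differences make their limits additive in the direction. -/
lemma HasUnifIncr.exists_fderiv {g : H → ℝ} (hg : HasUnifIncr g) (hc : Continuous g) :
    ∃ D : H → H →L[ℝ] ℝ,
      (∀ δ > 0, ∃ r > 0, ∀ x h, ‖h‖ ≤ r → |D x h - (g (x + h) - g x)| ≤ δ * ‖h‖) ∧
      ∀ δ > 0, ∃ r > 0, ∀ x k, ‖k‖ ≤ r → ‖D (x + k) - D x‖ ≤ δ := by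
  let a : H → H → ℕ → ℝ := fun x h n => 2 ^ n * (g (x + (2 ^ n : ℝ)⁻¹ • h) - g x)
  have hnorm : ∀ (h : H) (n : ℕ), ‖(2 ^ n : ℝ)⁻¹ • h‖ = (2 ^ n : ℝ)⁻¹ * ‖h‖ := fun h n => by
    rw [norm_smul, Real.norm_of_nonneg (by positivity)]
  have hsmall : ∀ (h : H) (r : ℝ), 0 < r → ∃ N : ℕ, ∀ n ≥ N, ‖(2 ^ n : ℝ)⁻¹ • h‖ ≤ r := by
    intro h r hr
    have : Tendsto (fun n : ℕ => (2 ^ n : ℝ)⁻¹ * ‖h‖) atTop (𝓝 (0 * ‖h‖)) := by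
      refine Tendsto.mul_const _ ?_
      simpa using tendsto_pow_atTop_nhds_zero_of_lt_one (r := (2⁻¹ : ℝ)) (by norm_num)
        (by norm_num)
    rw [zero_mul] at this
    obtain ⟨N, hN⟩ := eventually_atTop.1 (this.eventually (gt_mem_nhds hr))
    exact ⟨N, fun n hn => by rw [hnorm]; exact (hN n hn).le⟩
  have hscale : ∀ δ > 0, ∃ r > 0, ∀ x h n m, n ≤ m → ‖(2 ^ n : ℝ)⁻¹ • h‖ ≤ r →
      |a x h m - a x h n| ≤ δ * ‖h‖ := by
    intro δ hδ
    obtain ⟨r, hr, H1⟩ := hg δ hδ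
    refine ⟨r, hr, fun x h n m hnm hh => ?_⟩
    obtain ⟨j, rfl⟩ := Nat.exists_eq_add_of_le hnm
    have e1 : ((2 ^ j : ℕ) : ℝ) • ((2 ^ (n + j) : ℝ)⁻¹ • h) = (2 ^ n : ℝ)⁻¹ • h := by
      rw [smul_smul]; congr 1; push_cast; rw [pow_add]; field_simp
    have := HasUnifIncr.nsmul_sub_le H1 x ((2 ^ (n + j) : ℝ)⁻¹ • h) (2 ^ j) (by
      rw [← Real.norm_natCast, ← norm_smul, e1]; exact hh)
    rw [e1, hnorm] at this
    have e2 : a x h (n + j) - a x h n = 2 ^ n * (((2 ^ j : ℕ) : ℝ) *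
        (g (x + (2 ^ (n + j) : ℝ)⁻¹ • h) - g x) - (g (x + (2 ^ n : ℝ)⁻¹ • h) - g x)) := by
      simp only [a]; push_cast; rw [pow_add]; ring
    rw [e2, abs_mul, abs_of_pos (by positivity : (0 : ℝ) < 2 ^ n)]
    calc _ ≤ 2 ^ n * (((2 ^ j : ℕ) : ℝ) * (δ * ((2 ^ (n + j) : ℝ)⁻¹ * ‖h‖))) := by gcongr
      _ = δ * ‖h‖ := by push_cast; rw [pow_add]; field_simp
  have hlim : ∀ x h, ∃ d, Tendsto (a x h) atTop (𝓝 d) := by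
    intro x h
    refine cauchySeq_tendsto_of_complete (Metric.cauchySeq_iff'.2 fun e he => ?_)
    obtain ⟨r, hr, H1⟩ := hscale (e / (‖h‖ + 1)) (by positivity)
    obtain ⟨N, hN⟩ := hsmall h r hr
    refine ⟨N, fun n hn => ?_⟩
    rw [Real.dist_eq]
    refine (H1 x h N n hn (hN N le_rfl)).trans_lt ?_
    rw [div_mul_eq_mul_div, div_lt_iff₀ (by positivity)]
    nlinarith [norm_nonneg h]
  choose d hd using hlim
  have hdiff : ∀ δ > 0, ∃ r > 0, ∀ x h, ‖h‖ ≤ r → |d x h - (g (x + h) - g x)| ≤ δ * ‖h‖ := by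
    intro δ hδ
    obtain ⟨r, hr, H1⟩ := hscale δ hδ
    refine ⟨r, hr, fun x h hh => ?_⟩
    have e : a x h 0 = g (x + h) - g x := by simp [a]
    rw [← e]
    refine le_of_tendsto (((hd x h).sub_const _).abs) (Eventually.of_forall fun m => ?_)
    exact H1 x h 0 m (Nat.zero_le _) (by simpa using hh)
  have hadd : ∀ x h k, d x (h + k) = d x h + d x k := by
    intro x h k
    have h1 : Tendsto (fun n => a x (h + k) n - a x h n - a x k n) atTop (𝓝 0) := by
      rw [Metric.tendsto_atTop]
      intro e he
      obtain ⟨r, hr, H1⟩ := hg (e / (‖h‖ + 1)) (by positivity)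
      obtain ⟨N, hN⟩ := hsmall k r hr
      refine ⟨N, fun n hn => ?_⟩
      have h2 := H1 x ((2 ^ n : ℝ)⁻¹ • h) ((2 ^ n : ℝ)⁻¹ • k) (hN n hn)
      have e2 : a x (h + k) n - a x h n - a x k n = 2 ^ n * (g (x + (2 ^ n : ℝ)⁻¹ • h +
        (2 ^ n : ℝ)⁻¹ • k) - g (x + (2 ^ n : ℝ)⁻¹ • h) - g (x + (2 ^ n : ℝ)⁻¹ • k) + g x) := by
        simp only [a, smul_add, ← add_assoc]; ring
      rw [dist_zero_right, e2, norm_mul, Real.norm_of_nonneg (by positivity : (0 : ℝ) ≤ 2 ^ n)]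
      rw [hnorm] at h2
      calc _ ≤ 2 ^ n * (e / (‖h‖ + 1) * ((2 ^ n : ℝ)⁻¹ * ‖h‖)) := by gcongr
        _ = e * (‖h‖ / (‖h‖ + 1)) := by field_simp
        _ < e * 1 := by
          gcongr
          rw [div_lt_one (by positivity)]
          linarith
        _ = e := mul_one e
    have h2 := tendsto_nhds_unique h1 (((hd x (h + k)).sub (hd x h)).sub (hd x k))
    linarith
  let D0 : H → H →+ ℝ := fun x => AddMonoidHom.mk' (d x) (hadd x)
  have hcont : ∀ x, Continuous (D0 x) := by
    intro x
    refine continuous_of_continuousAt_zero _ ?_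
    obtain ⟨r, hr, H1⟩ := hdiff 1 one_pos
    have h0 : D0 x 0 = 0 := map_zero _
    rw [ContinuousAt, h0]
    have h1 : Tendsto (fun h : H => 1 * ‖h‖ + |g (x + h) - g x|) (𝓝 0) (𝓝 0) := by
      have : Continuous (fun h : H => 1 * ‖h‖ + |g (x + h) - g x|) := by fun_prop
      simpa using this.tendsto 0
    refine squeeze_zero_norm' ?_ h1
    filter_upwards [Metric.closedBall_mem_nhds (0 : H) hr] with h hh
    have := H1 x h (by simpa using hh)
    calc ‖D0 x h‖ = |(d x h - (g (x + h) - g x)) + (g (x + h) - g x)| := by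
          rw [Real.norm_eq_abs]; congr 1; simp [D0]
      _ ≤ _ := (abs_add_le _ _).trans (by linarith)
  refine ⟨fun x => (D0 x).toRealLinearMap (hcont x), hdiff, fun δ hδ => ?_⟩
  obtain ⟨r, hr, H1⟩ := hg δ hδ
  refine ⟨r, hr, fun x k hk => ContinuousLinearMap.opNorm_le_bound _ hδ.le fun h => ?_⟩
  change |d (x + k) h - d x h| ≤ _
  refine le_of_tendsto (((hd (x + k) h).sub (hd x h)).abs) (Eventually.of_forall fun n => ?_)
  have h2 := H1 x ((2 ^ n : ℝ)⁻¹ • h) k hk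
  rw [hnorm] at h2
  have e : a (x + k) h n - a x h n = 2 ^ n * (g (x + (2 ^ n : ℝ)⁻¹ • h + k) -
      g (x + (2 ^ n : ℝ)⁻¹ • h) - g (x + k) + g x) := by
    simp only [a]; rw [add_right_comm x k]; ring
  rw [e, abs_mul, abs_of_pos (by positivity : (0 : ℝ) < 2 ^ n)]
  calc _ ≤ 2 ^ n * (δ * ((2 ^ n : ℝ)⁻¹ * ‖h‖)) := by gcongr; exact h2
    _ = δ * ‖h‖ := by field_simp

lemma mem_Cb1_iff {φ : Cb H} : φ ∈ Cb1 H ↔ HasUnifIncr φ := by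
  constructor
  · rintro ⟨h1, h2, -⟩
    exact .of_fderiv h1 h2
  · intro h
    obtain ⟨D, h1, h2⟩ := h.exists_fderiv φ.uniformContinuous.continuous
    have hD : ∀ x, HasFDerivAt φ (D x) x := by
      intro x
      rw [hasFDerivAt_iff_isLittleO_nhds_zero, Asymptotics.isLittleO_iff]
      intro c hc
      obtain ⟨r, hr, H1⟩ := h1 c hc
      filter_upwards [Metric.closedBall_mem_nhds (0 : H) hr] with k hk
      rw [← norm_neg]
      convert H1 x k (by simpa using hk) using 1
      rw [Real.norm_eq_abs]; congr 1; ring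
    have e : fderiv ℝ φ = D := funext fun x => (hD x).fderiv
    refine ⟨fun x => (hD x).differentiableAt, ?_, ?_⟩
    · rw [e, Metric.uniformContinuous_iff]
      intro c hc
      obtain ⟨r, hr, H1⟩ := h2 (c / 2) (by positivity)
      refine ⟨r, hr, fun x y hxy => ?_⟩
      have := H1 y (x - y) (by rw [← dist_eq_norm]; exact hxy.le)
      rw [dist_eq_norm]
      rw [add_sub_cancel] at this
      linarith
    · obtain ⟨r, hr, H1⟩ := h1 1 one_pos
      refine ⟨(2 * ‖φ‖ + r) / r, fun x => ?_⟩
      rw [e]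
      -- the derivative is close to increments of the bounded function `φ` on a sphere of radius `r`
      refine ContinuousLinearMap.opNorm_le_of_unit_norm (𝕜 := ℝ) (by positivity) fun v hv => ?_
      have h3 := H1 x (r • v) (by rw [norm_smul, hv, Real.norm_of_nonneg hr.le, mul_one])
      rw [norm_smul, hv, Real.norm_of_nonneg hr.le, map_smul, smul_eq_mul] at h3
      have h4 := abs_le.1 (φ.abs_le_norm (x + r • v))
      have h5 := abs_le.1 (φ.abs_le_norm x)
      have h6 := abs_le.1 h3
      rw [Real.norm_eq_abs, le_div_iff₀ hr, ← abs_of_pos hr, ← abs_mul, abs_le, abs_of_pos hr]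
      constructor <;> nlinarith

lemma gradNorm_nonneg (φ : Cb H) : 0 ≤ gradNorm φ := Real.iSup_nonneg fun _ => norm_nonneg _

lemma abs_sub_le_gradNorm {φ : Cb H} (hφ : φ ∈ Cb1 H) (x y : H) :
    |φ x - φ y| ≤ gradNorm φ * ‖x - y‖ := by
  obtain ⟨h1, -, C, hC⟩ := hφ
  have hb : BddAbove (range fun x : H => ‖fderiv ℝ φ x‖) := ⟨C, by rintro _ ⟨x, rfl⟩; exact hC x⟩
  exact convex_univ.norm_image_sub_le_of_norm_fderiv_le (𝕜 := ℝ) (fun x _ => h1 x)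
    (fun x _ => le_ciSup hb x) (mem_univ y) (mem_univ x)

lemma gradNorm_le {φ : Cb H} {C : ℝ} (hC : 0 ≤ C) (h : ∀ x y, |φ x - φ y| ≤ C * ‖x - y‖) :
    gradNorm φ ≤ C := by
  refine ciSup_le fun x => ?_
  refine norm_fderiv_le_of_lipschitz (𝕜 := ℝ) (C := ⟨C, hC⟩) (LipschitzWith.of_dist_le_mul ?_)
  intro x y
  rw [dist_eq_norm, dist_eq_norm]
  exact h x y

lemma HasUnifIncr.of_forall_approx {g : H → ℝ}
    (h : ∀ δ > 0, ∃ f : H → ℝ, HasUnifIncr f ∧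
      ∀ x y, |(g x - f x) - (g y - f y)| ≤ δ * ‖x - y‖) : HasUnifIncr g := by
  intro δ hδ
  obtain ⟨f, hf, hgf⟩ := h (δ / 3) (by positivity)
  obtain ⟨r, hr, H1⟩ := hf (δ / 3) (by positivity)
  refine ⟨r, hr, fun x h k hk => ?_⟩
  have h1 := hgf (x + h + k) (x + k)
  have h2 := hgf (x + h) x
  rw [show x + h + k - (x + k) = h by abel] at h1
  rw [show x + h - x = h by abel] at h2
  have h3 := H1 x h k hk
  rw [Real.norm_eq_abs] at h3 ⊢
  rw [abs_le] at *
  constructor <;> linarith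

instance : CompleteSpace (Cb H) := by
  have hcl : IsClosed (CbSub H : Set (H →ᵇ ℝ)) := by
    refine isClosed_of_closure_subset fun f hf => ?_
    change UniformContinuous f
    rw [Metric.uniformContinuous_iff]
    intro e he
    obtain ⟨g, hg, hfg⟩ := Metric.mem_closure_iff.1 hf (e / 3) (by positivity)
    obtain ⟨r, hr, H1⟩ := Metric.uniformContinuous_iff.1 (show UniformContinuous g from hg) (e / 3)
      (by positivity)
    refine ⟨r, hr, fun {x y} hxy => ?_⟩
    have h1 := (BoundedContinuousFunction.dist_coe_le_dist (f := f) (g := g) x).trans_lt hfg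
    have h2 := (BoundedContinuousFunction.dist_coe_le_dist (f := f) (g := g) y).trans_lt hfg
    have h3 := H1 hxy
    rw [Real.dist_eq, abs_lt] at *
    constructor <;> linarith
  exact hcl.completeSpace_coe

/-! ### Density of `C_b^1(H)`: Lasry-Lions regularization -/

lemma norm_add_sq_add_norm_sub_sq (x y : H) :
    ‖x + y‖ ^ 2 + ‖x - y‖ ^ 2 = 2 * ‖x‖ ^ 2 + 2 * ‖y‖ ^ 2 := by
  have := parallelogram_law_with_norm ℝ x y
  linarith

/-- A function with quadratically bounded symmetric second differences has mixed differences
bounded by a multiple of `‖h‖ * ‖k‖`. -/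
lemma abs_mixedDiff_le_of_secondDiff {g : H → ℝ} {C : ℝ} (hC : 0 ≤ C)
    (hg : ∀ x h, |g (x + h) + g (x - h) - 2 * g x| ≤ C * ‖h‖ ^ 2) (x h k : H)
    (hhk : ‖h‖ ≤ ‖k‖) :
    |g (x + h + k) - g (x + h) - g (x + k) + g x| ≤ 2 * C * ‖h‖ * ‖k‖ := by
  -- the four points form a parallelogram with centre `x + (h + k) / 2`
  have key : ∀ x k, |g (x + h + k) - g (x + h) - g (x + k) + g x| ≤
      C * (‖h‖ ^ 2 + ‖k‖ ^ 2) / 2 := by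
    intro x k
    have h1 := hg (x + (2⁻¹ : ℝ) • (h + k)) ((2⁻¹ : ℝ) • (h + k))
    have h2 := hg (x + (2⁻¹ : ℝ) • (h + k)) ((2⁻¹ : ℝ) • (h - k))
    rw [show x + (2⁻¹ : ℝ) • (h + k) + (2⁻¹ : ℝ) • (h + k) = x + h + k by module,
      show x + (2⁻¹ : ℝ) • (h + k) - (2⁻¹ : ℝ) • (h + k) = x by module, norm_smul, mul_pow] at h1
    rw [show x + (2⁻¹ : ℝ) • (h + k) + (2⁻¹ : ℝ) • (h - k) = x + h by module,
      show x + (2⁻¹ : ℝ) • (h + k) - (2⁻¹ : ℝ) • (h - k) = x + k by module, norm_smul,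
      mul_pow] at h2
    have h3 := norm_add_sq_add_norm_sub_sq h k
    have h4 : ‖(2⁻¹ : ℝ)‖ ^ 2 = 1 / 4 := by norm_num
    rw [h4] at h1 h2
    have h5 : C * (1 / 4 * ‖h + k‖ ^ 2) + C * (1 / 4 * ‖h - k‖ ^ 2) =
        C * (‖h‖ ^ 2 + ‖k‖ ^ 2) / 2 := by rw [← mul_add, ← mul_add, h3]; ring
    rw [abs_le] at *
    constructor <;> linarith
  -- cutting the longer side into `n` pieces comparable to the shorter one replaces squares by
  -- products of the lengths
  have split : ∀ (k : H) (n : ℕ),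
      |g (x + h + (n : ℝ) • k) - g (x + h) - g (x + (n : ℝ) • k) + g x| ≤
        n * (C * (‖h‖ ^ 2 + ‖k‖ ^ 2) / 2) := by
    intro k n
    induction n with
    | zero => simp
    | succ n ih =>
      have h1 := key (x + (n : ℝ) • k) k
      push_cast
      rw [show x + h + ((n : ℝ) + 1) • k = x + (n : ℝ) • k + h + k by module,
        show x + ((n : ℝ) + 1) • k = x + (n : ℝ) • k + k by module]
      rw [show x + h + (n : ℝ) • k = x + (n : ℝ) • k + h by module] at ih
      rw [abs_le] at *
      constructor <;> linarith
  rcases eq_or_ne h 0 with rfl | hh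
  · simp
  have hh' : 0 < ‖h‖ := norm_pos_iff.2 hh
  set n := ⌈‖k‖ / ‖h‖⌉₊ with hn
  have hn1 : ‖k‖ / ‖h‖ ≤ n := Nat.le_ceil _
  have hn2 : (n : ℝ) < ‖k‖ / ‖h‖ + 1 := Nat.ceil_lt_add_one (by positivity)
  have hn0 : (0 : ℝ) < n := lt_of_lt_of_le (by have := hh'.trans_le hhk; positivity) hn1
  have h1 := split ((n : ℝ)⁻¹ • k) n
  rw [smul_inv_smul₀ hn0.ne', norm_smul, norm_inv, Real.norm_natCast] at h1
  refine h1.trans ?_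
  rw [div_le_iff₀ hh'] at hn1
  have h2 : (n : ℝ)⁻¹ * ‖k‖ ≤ ‖h‖ := by rwa [inv_mul_le_iff₀ hn0]
  have h3 : n * ‖h‖ ≤ 2 * ‖k‖ := by
    have : n * ‖h‖ ≤ (‖k‖ / ‖h‖ + 1) * ‖h‖ := by gcongr
    rw [add_mul, div_mul_cancel₀ _ hh'.ne'] at this
    linarith
  calc _ ≤ n * (C * (‖h‖ ^ 2 + ‖h‖ ^ 2) / 2) := by gcongr
    _ = C * ‖h‖ * (n * ‖h‖) := by ring
    _ ≤ C * ‖h‖ * (2 * ‖k‖) := by gcongr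
    _ = _ := by ring

lemma HasUnifIncr.of_secondDiff {g : H → ℝ} {C : ℝ} (hC : 0 ≤ C)
    (hg : ∀ x h, |g (x + h) + g (x - h) - 2 * g x| ≤ C * ‖h‖ ^ 2) : HasUnifIncr g := by
  intro δ hδ
  refine ⟨δ / (2 * C + 1), by positivity, fun x h k hk => ?_⟩
  rw [le_div_iff₀ (by positivity)] at hk
  have h1 : |g (x + h + k) - g (x + h) - g (x + k) + g x| ≤ 2 * C * ‖h‖ * ‖k‖ := by
    rcases le_total ‖h‖ ‖k‖ with hhk | hhk
    · exact abs_mixedDiff_le_of_secondDiff hC hg x h k hhk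
    · have := abs_mixedDiff_le_of_secondDiff hC hg x k h hhk
      rw [add_right_comm] at this
      convert this using 1
      · congr 1; ring
      · ring
  refine h1.trans ?_
  nlinarith [norm_nonneg h, norm_nonneg k, mul_nonneg (norm_nonneg h) (norm_nonneg k)]

/-- The Moreau envelope `x ↦ inf_y (f y + c |x - y|²)`. -/
def moreau (c : ℝ) (f : H → ℝ) (x : H) : ℝ := ⨅ y, (f y + c * ‖x - y‖ ^ 2)

section Moreau

variable {c B : ℝ} {f : H → ℝ}

lemma moreau_le_add (hc : 0 ≤ c) (hB : ∀ x, |f x| ≤ B) (x y : H) :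
    moreau c f x ≤ f y + c * ‖x - y‖ ^ 2 :=
  ciInf_le ⟨-B, by
    rintro _ ⟨z, rfl⟩
    dsimp only
    nlinarith [mul_nonneg hc (sq_nonneg ‖x - z‖), (abs_le.1 (hB z)).1]⟩ y

lemma moreau_le (hc : 0 ≤ c) (hB : ∀ x, |f x| ≤ B) (x : H) : moreau c f x ≤ f x := by
  simpa using moreau_le_add hc hB x x

lemma abs_moreau_le (hc : 0 ≤ c) (hB : ∀ x, |f x| ≤ B) (x : H) : |moreau c f x| ≤ B := by
  refine abs_le.2 ⟨le_ciInf fun y => ?_, (moreau_le hc hB x).trans (abs_le.1 (hB x)).2⟩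
  nlinarith [mul_nonneg hc (sq_nonneg ‖x - y‖), (abs_le.1 (hB y)).1]

/-- The envelope commutes with translations, so it inherits the modulus of continuity. -/
lemma moreau_add_le (hc : 0 ≤ c) (hB : ∀ x, |f x| ≤ B) {d : H} {e : ℝ}
    (h : ∀ y, f (y + d) ≤ f y + e) (x : H) : moreau c f (x + d) ≤ moreau c f x + e := by
  rw [← sub_le_iff_le_add]
  refine le_ciInf fun y => ?_
  have := moreau_le_add hc hB (x + d) (y + d)
  rw [add_sub_add_right_eq_sub] at this
  linarith [h y]

lemma uniformContinuous_moreau (hc : 0 ≤ c) (hB : ∀ x, |f x| ≤ B) (hf : UniformContinuous f) :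
    UniformContinuous (moreau c f) := by
  rw [Metric.uniformContinuous_iff] at *
  intro e he
  obtain ⟨r, hr, H1⟩ := hf (e / 2) (by positivity)
  have key : ∀ x y, dist x y < r → moreau c f x ≤ moreau c f y + e / 2 := by
    intro x y hxy
    have := moreau_add_le hc hB (d := x - y) (e := e / 2) (fun z => ?_) y
    · rwa [add_sub_cancel] at this
    · have := H1 (show dist (z + (x - y)) z < r by simpa [dist_eq_norm] using hxy)
      rw [Real.dist_eq, abs_lt] at this
      linarith
  refine ⟨r, hr, fun x y hxy => ?_⟩
  have h1 := key x y hxy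
  have h2 := key y x (by rwa [dist_comm])
  rw [Real.dist_eq, abs_lt]
  constructor <;> linarith

lemma moreau_secondDiff_le (hc : 0 ≤ c) (hB : ∀ x, |f x| ≤ B) (x h : H) :
    moreau c f (x + h) + moreau c f (x - h) ≤ 2 * moreau c f x + 2 * c * ‖h‖ ^ 2 := by
  have : (moreau c f (x + h) + moreau c f (x - h) - 2 * c * ‖h‖ ^ 2) / 2 ≤ moreau c f x := by
    refine le_ciInf fun y => ?_
    have h1 := moreau_le_add hc hB (x + h) y
    have h2 := moreau_le_add hc hB (x - h) y
    have h3 := norm_add_sq_add_norm_sub_sq (x - y) h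
    rw [show x - y + h = x + h - y by abel, show x - y - h = x - h - y by abel] at h3
    have h4 : c * ‖x + h - y‖ ^ 2 + c * ‖x - h - y‖ ^ 2 = c * (2 * ‖x - y‖ ^ 2 + 2 * ‖h‖ ^ 2) := by
      rw [← h3]; ring
    linarith
  linarith

/-- If `f y ≥ f x - δ - c |x - y|²`, then the envelope is `δ`-close to `f`. -/
lemma le_moreau_add {δ : ℝ} (h : ∀ x y, f x ≤ f y + δ + c * ‖x - y‖ ^ 2) (x : H) :
    f x ≤ moreau c f x + δ := by
  rw [← sub_le_iff_le_add]
  exact le_ciInf fun y => by linarith [h x y]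

/-- The Lasry-Lions regularization: a lower envelope followed by an upper envelope with twice the
constant. -/
def lasryLions (c : ℝ) (f : H → ℝ) (x : H) : ℝ := -moreau (2 * c) (fun z => -moreau c f z) x

lemma abs_neg_moreau_le (hc : 0 ≤ c) (hB : ∀ x, |f x| ≤ B) (x : H) : |-moreau c f x| ≤ B := by
  rw [abs_neg]; exact abs_moreau_le hc hB x

/-- The regularization is semiconvex as a supremum of paraboloids; it stays semiconcave because
the second envelope is the steeper one. -/
lemma lasryLions_secondDiff (hc : 0 ≤ c) (hB : ∀ x, |f x| ≤ B) (x h : H) :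
    |lasryLions c f (x + h) + lasryLions c f (x - h) - 2 * lasryLions c f x| ≤
      4 * c * ‖h‖ ^ 2 := by
  have hB' := abs_neg_moreau_le hc hB
  have h2c : 0 ≤ 2 * c := by positivity
  rw [abs_le]
  constructor
  · have := moreau_secondDiff_le h2c hB' x h
    simp only [lasryLions]
    linarith
  · have key : ∀ p q : H, moreau c f p - 2 * c * ‖x + h - p‖ ^ 2 +
        (moreau c f q - 2 * c * ‖x - h - q‖ ^ 2) ≤ 2 * lasryLions c f x + 4 * c * ‖h‖ ^ 2 := by
      intro p q
      set m := (2⁻¹ : ℝ) • (p + q) with hm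
      set k := (2⁻¹ : ℝ) • (p - q) with hk
      have h1 := moreau_secondDiff_le hc hB m k
      rw [show m + k = p by rw [hm, hk]; module, show m - k = q by rw [hm, hk]; module] at h1
      have h2 := moreau_le_add h2c hB' x m
      have h3 := norm_add_sq_add_norm_sub_sq (x - m) (h - k)
      rw [show x - m + (h - k) = x + h - p by rw [hm, hk]; module,
        show x - m - (h - k) = x - h - q by rw [hm, hk]; module] at h3
      have h4 := norm_add_sq_add_norm_sub_sq h (h - k)
      rw [sub_sub_cancel] at h4
      have h5 : 2 * c * ‖x + h - p‖ ^ 2 + 2 * c * ‖x - h - q‖ ^ 2 =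
          2 * c * (2 * ‖x - m‖ ^ 2 + 2 * ‖h - k‖ ^ 2) := by rw [← h3]; ring
      have h6 : c * ‖k‖ ^ 2 ≤ c * (2 * ‖h‖ ^ 2 + 2 * ‖h - k‖ ^ 2) := by
        gcongr
        nlinarith [sq_nonneg ‖h + (h - k)‖]
      simp only [lasryLions]
      linarith
    have k1 : ∀ p, moreau c f p - 2 * c * ‖x + h - p‖ ^ 2 + lasryLions c f (x - h) ≤
        2 * lasryLions c f x + 4 * c * ‖h‖ ^ 2 := by
      intro p
      have : moreau c f p - 2 * c * ‖x + h - p‖ ^ 2 - (2 * lasryLions c f x + 4 * c * ‖h‖ ^ 2) ≤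
          moreau (2 * c) (fun z => -moreau c f z) (x - h) :=
        le_ciInf fun q => by linarith [key p q]
      simp only [lasryLions] at *
      linarith
    have : lasryLions c f (x - h) - (2 * lasryLions c f x + 4 * c * ‖h‖ ^ 2) ≤
        moreau (2 * c) (fun z => -moreau c f z) (x + h) :=
      le_ciInf fun p => by linarith [k1 p]
    rw [show lasryLions c f (x + h) = -moreau (2 * c) (fun z => -moreau c f z) (x + h) from rfl]
    linarith

lemma abs_lasryLions_sub_le (hc : 0 ≤ c) (hB : ∀ x, |f x| ≤ B) {δ : ℝ}
    (h : ∀ x y, f x ≤ f y + δ + c * ‖x - y‖ ^ 2) (x : H) : |lasryLions c f x - f x| ≤ δ := by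
  have h2c : 0 ≤ 2 * c := by positivity
  have h1 := moreau_le h2c (abs_neg_moreau_le hc hB) x
  have h2 := le_moreau_add h x
  have h3 : -f x - δ ≤ moreau (2 * c) (fun z => -moreau c f z) x := by
    refine le_ciInf fun y => ?_
    have h4 := moreau_le hc hB y
    have h5 := h y x
    rw [norm_sub_rev] at h5
    nlinarith [mul_nonneg hc (sq_nonneg ‖x - y‖)]
  simp only [lasryLions]
  rw [abs_le]
  constructor <;> linarith

end Moreau

/-- `C_b^1(H)` is dense in `C_b(H)`. -/
lemma exists_mem_Cb1_norm_sub_le (f : Cb H) {δ : ℝ} (hδ : 0 < δ) :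
    ∃ g ∈ Cb1 H, ‖g - f‖ ≤ δ := by
  obtain ⟨r, hr, H1⟩ := Metric.uniformContinuous_iff.1 f.uniformContinuous δ hδ
  set c := 2 * ‖f‖ / r ^ 2 with hc
  have hc0 : 0 ≤ c := by positivity
  have hB := f.abs_le_norm
  have hq : ∀ x y, f x ≤ f y + δ + c * ‖x - y‖ ^ 2 := by
    intro x y
    rcases lt_or_ge (dist x y) r with hxy | hxy
    · have := H1 hxy
      rw [Real.dist_eq, abs_lt] at this
      nlinarith [mul_nonneg hc0 (sq_nonneg ‖x - y‖)]
    · rw [dist_eq_norm] at hxy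
      have h1 : 2 * ‖f‖ ≤ c * ‖x - y‖ ^ 2 := by
        rw [hc, div_mul_eq_mul_div, le_div_iff₀ (by positivity)]
        gcongr
      have h2 := abs_le.1 (hB x)
      have h3 := abs_le.1 (hB y)
      linarith
  have hu : UniformContinuous (lasryLions c f) :=
    (uniformContinuous_moreau (by positivity) (abs_neg_moreau_le hc0 hB)
      (uniformContinuous_moreau hc0 hB f.uniformContinuous).neg).neg
  have hb : ∀ x, |lasryLions c f x| ≤ ‖f‖ := fun x => by
    rw [lasryLions, abs_neg]
    exact abs_moreau_le (by positivity) (abs_neg_moreau_le hc0 hB) x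
  let g : Cb H := ⟨BoundedContinuousFunction.ofNormedAddCommGroup _ hu.continuous ‖f‖ hb, hu⟩
  refine ⟨g, mem_Cb1_iff.2 (.of_secondDiff (C := 4 * c) (by positivity) ?_), ?_⟩
  · exact fun x h => lasryLions_secondDiff hc0 hB x h
  · exact Cb.norm_le hδ.le fun x => abs_lasryLions_sub_le hc0 hB hq x

/-! ### The flow of a `C_b^1` vector field -/

section Flow

variable [CompleteSpace H] {F : H → H} {K : ℝ}

lemma IsCb1Field.norm_sub_le (hF : IsCb1Field F) (x y : H) :
    ‖F x - F y‖ ≤ (⨆ x : H, ‖fderiv ℝ F x‖) * ‖x - y‖ := by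
  obtain ⟨h1, -, C, hC⟩ := hF
  have hb : BddAbove (range fun x : H => ‖fderiv ℝ F x‖) := ⟨C, by rintro _ ⟨x, rfl⟩; exact hC x⟩
  exact convex_univ.norm_image_sub_le_of_norm_fderiv_le (𝕜 := ℝ) (fun x _ => h1 x)
    (fun x _ => le_ciSup hb x) (mem_univ y) (mem_univ x)

/-- The local solutions of Picard-Lindelöf live on time intervals of a common length, as `F` is
globally Lipschitz continuous; hence they extend to global solutions. -/
lemma IsCb1Field.exists_solution (hF : IsCb1Field F) (x : H) :
    ∃ u : ℝ → H, u 0 = x ∧ ∀ s : ℝ, HasDerivAt u (F (u s)) s := by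
  have hc : ContDiff ℝ 1 F := contDiff_one_iff_fderiv.2 ⟨hF.1, hF.2.1.continuous⟩
  have hK : 0 ≤ ⨆ x : H, ‖fderiv ℝ F x‖ := Real.iSup_nonneg fun _ => norm_nonneg _
  set K := ⨆ x : H, ‖fderiv ℝ F x‖ with hKd
  have hT : 0 < 1 / (2 * (K + 1)) := by positivity
  have hloc : ∀ x : H, ∃ γ : ℝ → H, γ 0 = x ∧ IsMIntegralCurveOn (I := modelWithCornersSelf ℝ H)
      γ F (Ioo (-(1 / (2 * (K + 1)))) (1 / (2 * (K + 1)))) := by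
    intro x
    have hP : IsPicardLindelof (fun _ => F) (tmin := -(1 / (2 * (K + 1))))
        (tmax := 1 / (2 * (K + 1))) ⟨0, by constructor <;> linarith⟩ x
        ⟨‖F x‖ + 1, by positivity⟩ 0 ⟨‖F x‖ + K * (‖F x‖ + 1), by positivity⟩ ⟨K, hK⟩ := by
      refine .of_time_independent (fun y hy => ?_) (fun y _ z _ => ?_) ?_
      · have h1 := hF.norm_sub_le y x
        have h2 : ‖y - x‖ ≤ ‖F x‖ + 1 := by
          have h0 : dist y x ≤ ‖F x‖ + 1 := hy
          rwa [dist_eq_norm] at h0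
        change ‖F y‖ ≤ ‖F x‖ + K * (‖F x‖ + 1)
        have h3 : ‖F y‖ ≤ ‖F x‖ + ‖F y - F x‖ := by
          simpa using norm_add_le (F x) (F y - F x)
        have h4 : K * ‖y - x‖ ≤ K * (‖F x‖ + 1) := by gcongr
        linarith
      · exact (LipschitzWith.of_dist_le_mul (K := ⟨K, hK⟩) fun y z => by
          rw [dist_eq_norm, dist_eq_norm]; exact hF.norm_sub_le y z) y z
      · simp only [sub_zero, zero_sub, neg_neg, max_self, NNReal.coe_zero]
        change (‖F x‖ + K * (‖F x‖ + 1)) * (1 / (2 * (K + 1))) ≤ ‖F x‖ + 1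
        rw [mul_one_div, div_le_iff₀ (by positivity)]
        nlinarith [norm_nonneg (F x), mul_nonneg hK (norm_nonneg (F x))]
    obtain ⟨u, h0, hu⟩ := hP.exists_eq_forall_mem_Icc_hasDerivWithinAt₀
    refine ⟨u, h0, fun t ht => ?_⟩
    have h1 := ((hu t (Ioo_subset_Icc_self ht)).mono Ioo_subset_Icc_self).hasFDerivWithinAt
    rw [← ContinuousLinearMap.smulRight_id] at h1
    exact h1.hasMFDerivWithinAt
  obtain ⟨u, h0, hu⟩ := exists_isMIntegralCurve_of_isMIntegralCurveOn
    (contMDiff_vectorSpace_iff_contDiff.2 hc) hT hloc x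
  refine ⟨u, h0, fun s => ?_⟩
  have h : HasFDerivAt u ((1 : ℝ →L[ℝ] ℝ).smulRight (F (u s))) s := (hu s).hasFDerivAt
  simpa using h.hasDerivAt

lemma IsCb1Field.flow_zero_and_hasDerivWithinAt (hF : IsCb1Field F) (x : H) :
    flow F 0 x = x ∧
      ∀ s : ℝ, 0 ≤ s → HasDerivWithinAt (fun t => flow F t x) (F (flow F s x)) (Ici 0) s := by
  have h : ∃ u : ℝ → H, u 0 = x ∧ ∀ s : ℝ, 0 ≤ s → HasDerivWithinAt u (F (u s)) (Ici 0) s := by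
    obtain ⟨u, h0, hu⟩ := hF.exists_solution x
    exact ⟨u, h0, fun s _ => (hu s).hasDerivWithinAt⟩
  have e : ∀ t, flow F t x = h.choose t := fun t => by unfold flow; rw [dif_pos h]
  simp only [e]
  exact h.choose_spec

lemma IsCb1Field.continuousOn_flow (hF : IsCb1Field F) (x : H) (a : ℝ) :
    ContinuousOn (fun t => flow F t x) (Icc 0 a) := fun s hs =>
  ((hF.flow_zero_and_hasDerivWithinAt x).2 s hs.1).continuousWithinAt.mono Icc_subset_Ici_self

lemma IsCb1Field.hasDerivWithinAt_flow (hF : IsCb1Field F) (x : H) {s : ℝ} (hs : 0 ≤ s) :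
    HasDerivWithinAt (fun t => flow F t x) (F (flow F s x)) (Ici s) s :=
  ((hF.flow_zero_and_hasDerivWithinAt x).2 s hs).mono (Ici_subset_Ici.2 hs)

lemma IsCb1Field.norm_flow_sub_le (hF : IsCb1Field F) (hK : 0 ≤ K)
    (hKF : ∀ x y, ‖F x - F y‖ ≤ K * ‖x - y‖) {t : ℝ} (ht : 0 ≤ t) (x y : H) :
    ‖flow F t x - flow F t y‖ ≤ Real.exp (K * t) * ‖x - y‖ := by
  have := dist_le_of_trajectories_ODE (v := fun _ => F) (K := ⟨K, hK⟩)
    (fun _ => LipschitzWith.of_dist_le_mul fun x y => by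
      rw [dist_eq_norm, dist_eq_norm]; exact hKF x y)
    (hF.continuousOn_flow x t) (fun s hs => hF.hasDerivWithinAt_flow x hs.1)
    (hF.continuousOn_flow y t) (fun s hs => hF.hasDerivWithinAt_flow y hs.1)
    (by rw [(hF.flow_zero_and_hasDerivWithinAt x).1, (hF.flow_zero_and_hasDerivWithinAt y).1])
    t ⟨ht, le_rfl⟩
  rw [dist_eq_norm, dist_eq_norm, sub_zero, mul_comm] at this
  exact this

/-- For a function `g` with small mixed differences, the second difference along the vertices
`p, q, p', q'` of an almost parallelogram is small, up to its defect `q' - p' - q + p`. -/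
lemma norm_secondDiff_le {E : Type*} [NormedAddCommGroup E] {g : H → E} {δ r L : ℝ}
    (hg : ∀ x h k, ‖k‖ ≤ r → ‖g (x + h + k) - g (x + h) - g (x + k) + g x‖ ≤ δ * ‖h‖)
    (hL : ∀ x y, ‖g x - g y‖ ≤ L * ‖x - y‖) (p q p' q' : H) (hp : ‖p' - p‖ ≤ r) :
    ‖g q' - g q - g p' + g p‖ ≤ δ * ‖q - p‖ + L * ‖q' - q - p' + p‖ := by
  have h1 := hg p (q - p) (p' - p) hp
  have h2 := hL q' (q + (p' - p))
  rw [add_sub_cancel, add_sub_cancel] at h1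
  calc _ = ‖(g (q + (p' - p)) - g q - g p' + g p) + (g q' - g (q + (p' - p)))‖ := by
        congr 1; abel
    _ ≤ _ := norm_add_le _ _
    _ ≤ _ := by
      refine add_le_add h1 (h2.trans_eq ?_)
      congr 2; abel

/-- The flow has small mixed differences: these satisfy a linear differential inequality with a
small source term, so Grönwall's inequality applies. -/
lemma IsCb1Field.hasUnifIncr_flow (hF : IsCb1Field F) (hK : 0 ≤ K)
    (hKF : ∀ x y, ‖F x - F y‖ ≤ K * ‖x - y‖) {t : ℝ} (ht : 0 ≤ t) :
    HasUnifIncr (flow F t) := by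
  intro δ hδ
  set M := Real.exp (K * t) with hM
  have hM0 : 0 < M := Real.exp_pos _
  set G := Real.exp ((K + 1) * t) with hG
  have hG0 : 0 < G := Real.exp_pos _
  obtain ⟨r, hr, H1⟩ := HasUnifIncr.of_fderiv hF.1 hF.2.1 (δ / (M * G)) (by positivity)
  refine ⟨r / M, by positivity, fun x h k hk => ?_⟩
  rw [le_div_iff₀ hM0] at hk
  have hlip : ∀ s ∈ Ico 0 t, ∀ y z, ‖flow F s y - flow F s z‖ ≤ M * ‖y - z‖ := by
    intro s hs y z
    refine (hF.norm_flow_sub_le hK hKF hs.1 y z).trans ?_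
    have := hs.2.le
    rw [hM]
    gcongr
  have := norm_le_gronwallBound_of_norm_deriv_right_le (a := 0) (b := t)
    (f := fun s => flow F s (x + h + k) - flow F s (x + h) - flow F s (x + k) + flow F s x)
    (f' := fun s => F (flow F s (x + h + k)) - F (flow F s (x + h)) - F (flow F s (x + k)) +
      F (flow F s x)) (δ := 0) (K := K + 1) (ε := δ / (M * G) * (M * ‖h‖))
    ((((hF.continuousOn_flow _ t).sub (hF.continuousOn_flow _ t)).sub
      (hF.continuousOn_flow _ t)).add (hF.continuousOn_flow _ t))
    (fun s hs => (((hF.hasDerivWithinAt_flow _ hs.1).sub (hF.hasDerivWithinAt_flow _ hs.1)).sub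
      (hF.hasDerivWithinAt_flow _ hs.1)).add (hF.hasDerivWithinAt_flow _ hs.1))
    (by
      simp only [(hF.flow_zero_and_hasDerivWithinAt _).1]
      rw [show x + h + k - (x + h) - (x + k) + x = 0 by abel, norm_zero])
    (fun s hs => by
      have h1 := norm_secondDiff_le H1 hKF (flow F s x) (flow F s (x + h)) (flow F s (x + k))
        (flow F s (x + h + k)) (by
          refine (hlip s hs _ _).trans ?_
          rw [add_sub_cancel_left]
          linarith)
      have h2 := hlip s hs (x + h) x
      rw [add_sub_cancel_left] at h2
      have h3 : δ / (M * G) * ‖flow F s (x + h) - flow F s x‖ ≤ δ / (M * G) * (M * ‖h‖) := by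
        gcongr
      have h4 := norm_nonneg (flow F s (x + h + k) - flow F s (x + h) - flow F s (x + k) +
        flow F s x)
      linarith)
    t ⟨ht, le_rfl⟩
  refine this.trans ?_
  rw [gronwallBound_of_K_ne_0 (by positivity), sub_zero]
  simp only [zero_mul, zero_add]
  calc _ ≤ δ / (M * G) * (M * ‖h‖) / 1 * G := by
        have h1 : 1 ≤ K + 1 := by linarith
        have h2 : Real.exp ((K + 1) * t) - 1 ≤ G := by linarith
        have h3 : 0 ≤ Real.exp ((K + 1) * t) - 1 := by
          rw [sub_nonneg, Real.one_le_exp_iff]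
          positivity
        gcongr
    _ = δ * ‖h‖ := by field_simp

lemma HasUnifIncr.comp {φ : H → ℝ} {η : H → H} {L M : ℝ} (hφ : HasUnifIncr φ)
    (hL : ∀ x y, |φ x - φ y| ≤ L * ‖x - y‖) (hL0 : 0 ≤ L) (hη : HasUnifIncr η)
    (hM : ∀ x y, ‖η x - η y‖ ≤ M * ‖x - y‖) (hM0 : 0 ≤ M) : HasUnifIncr (φ ∘ η) := by
  intro δ hδ
  obtain ⟨r₁, hr₁, H1⟩ := hφ (δ / (2 * (M + 1))) (by positivity)
  obtain ⟨r₂, hr₂, H2⟩ := hη (δ / (2 * (L + 1))) (by positivity)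
  refine ⟨min (r₁ / (M + 1)) r₂, by positivity, fun x h k hk => ?_⟩
  have hk1 := hk.trans (min_le_left _ _)
  have hk2 := hk.trans (min_le_right _ _)
  rw [le_div_iff₀ (by positivity)] at hk1
  have h1 := norm_secondDiff_le H1 hL (η x) (η (x + h)) (η (x + k)) (η (x + h + k)) (by
    refine (hM _ _).trans ?_
    rw [add_sub_cancel_left]
    nlinarith [norm_nonneg k])
  have h2 := hM (x + h) x
  rw [add_sub_cancel_left] at h2
  refine h1.trans ?_
  calc _ ≤ δ / (2 * (M + 1)) * ((M + 1) * ‖h‖) + (L + 1) * (δ / (2 * (L + 1)) * ‖h‖) := by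
        gcongr
        · refine h2.trans ?_
          gcongr
          linarith
        · linarith
        · exact H2 x h k hk2
    _ = δ * ‖h‖ := by field_simp; ring

lemma IsCb1Field.uniformContinuous_flow (hF : IsCb1Field F) {t : ℝ} (ht : 0 ≤ t) :
    UniformContinuous (flow F t) :=
  (LipschitzWith.of_dist_le_mul (K := ⟨_, (Real.exp_pos _).le⟩) fun x y => by
    rw [dist_eq_norm, dist_eq_norm]
    exact hF.norm_flow_sub_le (Real.iSup_nonneg fun _ => norm_nonneg _) hF.norm_sub_le ht
      x y).uniformContinuous

/-- Composition with the flow at time `t` maps `C_b^1(H)` to itself, and increases the Lipschitz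
constant at most by the factor `e^{Kt}`. -/
lemma IsCb1Field.compOp_flow_mem_Cb1 (hF : IsCb1Field F) (hK : K = ⨆ x : H, ‖fderiv ℝ F x‖)
    {t : ℝ} (ht : 0 ≤ t) {φ : Cb H} (hφ : φ ∈ Cb1 H) :
    compOp (flow F t) φ ∈ Cb1 H ∧
      gradNorm (compOp (flow F t) φ) ≤ Real.exp (K * t) * gradNorm φ := by
  have hK0 : 0 ≤ K := hK ▸ Real.iSup_nonneg fun _ => norm_nonneg _
  have hKF : ∀ x y, ‖F x - F y‖ ≤ K * ‖x - y‖ := fun x y => hK ▸ hF.norm_sub_le x y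
  have hlip := hF.norm_flow_sub_le hK0 hKF ht
  have e : ∀ x, compOp (flow F t) φ x = φ (flow F t x) :=
    compOp_apply (hF.uniformContinuous_flow ht) φ
  constructor
  · rw [mem_Cb1_iff]
    have := (mem_Cb1_iff.1 hφ).comp (abs_sub_le_gradNorm hφ) (gradNorm_nonneg φ)
      (hF.hasUnifIncr_flow hK0 hKF ht) hlip (Real.exp_pos _).le
    rwa [show ((compOp (flow F t) φ : Cb H) : H → ℝ) = φ ∘ flow F t from funext e]
  · refine gradNorm_le (mul_nonneg (Real.exp_pos _).le (gradNorm_nonneg φ)) fun x y => ?_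
    rw [e, e]
    refine (abs_sub_le_gradNorm hφ _ _).trans ?_
    rw [mul_comm (Real.exp _), mul_assoc]
    exact mul_le_mul_of_nonneg_left (hlip x y) (gradNorm_nonneg φ)

lemma norm_compOp_le (g : H → H) (φ : Cb H) : ‖compOp g φ‖ ≤ ‖φ‖ := by
  by_cases hg : UniformContinuous g
  · refine Cb.norm_le (norm_nonneg _) fun x => ?_
    rw [compOp_apply hg]
    exact φ.abs_le_norm _
  · simp [compOp, hg]

end Flow

/-! ### Symmetric positive trace class operators -/

lemma countable_of_hilbertBasis [TopologicalSpace.SeparableSpace H] {ι : Type*}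
    (e : HilbertBasis ι ℝ H) : Countable ι := by
  refine Pairwise.countable_of_isOpen_disjoint (s := fun i => Metric.ball (e i) (1 / 2))
    (fun i j hij => ?_) (fun i => Metric.isOpen_ball) (fun i => ⟨e i, by simp⟩)
  refine Metric.ball_disjoint_ball ?_
  have h1 : ‖e i - e j‖ ^ 2 = 2 := by
    rw [norm_sub_sq_real, e.orthonormal.1 i, e.orthonormal.1 j, e.orthonormal.2 hij]
    norm_num
  rw [dist_eq_norm]
  nlinarith [norm_nonneg (e i - e j)]

lemma IsTraceClass.summable_inner {T : H → H} (hT : IsTraceClass T) {ι : Type*} {e : ι → H}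
    (he : Orthonormal ℝ e) (hpos : ∀ x, 0 ≤ inner ℝ (T x) x) :
    Summable fun i => inner ℝ (T (e i)) (e i) := by
  obtain ⟨a, b, hab, hT⟩ := hT
  refine summable_of_sum_le (c := ∑' n, ‖a n‖ * ‖b n‖) (fun i => hpos _) fun s => ?_
  have h1 : HasSum (fun n => ∑ i ∈ s, inner ℝ (a n) (e i) * inner ℝ (b n) (e i))
      (∑ i ∈ s, inner ℝ (T (e i)) (e i)) := by
    refine hasSum_sum fun i _ => ?_
    have := (hT (e i)).mapL (innerSL ℝ (e i))
    simpa only [innerSL_apply_apply, inner_smul_right, real_inner_comm] using this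
  rw [← h1.tsum_eq]
  refine h1.summable.tsum_le_tsum (fun n => ?_) hab
  calc _ ≤ √(∑ i ∈ s, inner ℝ (a n) (e i) ^ 2) * √(∑ i ∈ s, inner ℝ (b n) (e i) ^ 2) :=
        Real.sum_mul_le_sqrt_mul_sqrt _ _ _
    _ ≤ √(‖a n‖ ^ 2) * √(‖b n‖ ^ 2) := by
        have bessel : ∀ x, ∑ i ∈ s, inner ℝ x (e i) ^ 2 ≤ ‖x‖ ^ 2 := fun x => by
          have := he.sum_inner_products_le (x := x) (s := s)
          simpa only [Real.norm_eq_abs, sq_abs, real_inner_comm] using this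
        gcongr <;> exact bessel _
    _ = _ := by rw [Real.sqrt_sq (norm_nonneg _), Real.sqrt_sq (norm_nonneg _)]

section GaussianMeasures

variable [CompleteSpace H]

lemma IsTraceClass.exists_compact {T : H → H} (hT : IsTraceClass T) :
    ∃ T' : H →L[ℝ] H, IsCompactOperator T' ∧ ∀ x, T' x = T x := by
  obtain ⟨a, b, hab, hT⟩ := hT
  let f : ℕ → H →L[ℝ] H := fun n => (innerSL ℝ (a n)).smulRight (b n)
  have hf : Summable f := by
    refine Summable.of_norm (hab.congr fun n => ?_)
    simp [f, ContinuousLinearMap.norm_smulRight_apply]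
  refine ⟨∑' n, f n, ?_, fun x => ?_⟩
  · refine isCompactOperator_of_tendsto hf.hasSum (Eventually.of_forall fun s => ?_)
    exact (compactOperator (RingHom.id ℝ) H H).sum_mem fun n _ =>
      (isCompactOperator_of_locallyCompactSpace_dom
        (innerSL ℝ (a n) : H →L[ℝ] ℝ)).clm_comp (ContinuousLinearMap.toSpanSingleton ℝ (b n))
  · have h1 := (hf.hasSum).mapL (ContinuousLinearMap.apply ℝ H x)
    exact h1.unique (hT x)

/-- Diagonalization of compact self-adjoint operators. -/
lemma exists_eigenbasis.{u} {H : Type u} [NormedAddCommGroup H] [InnerProductSpace ℝ H]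
    [CompleteSpace H] {T : H →L[ℝ] H} (hT : IsCompactOperator T)
    (hs : (T : H →ₗ[ℝ] H).IsSymmetric) :
    ∃ (ι : Type u) (e : HilbertBasis ι ℝ H) (l : ι → ℝ), ∀ i, T (e i) = l i • e i := by
  have hcl : ∀ μ, CompleteSpace (Module.End.eigenspace (T : Module.End ℝ H) μ) := fun μ => by
    refine IsClosed.completeSpace_coe (hs := ?_)
    have : (Module.End.eigenspace (T : Module.End ℝ H) μ : Set H) = {x | T x = μ • x} := by
      ext x; simp
    rw [this]
    exact isClosed_eq T.continuous (continuous_const_smul μ)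
  choose w b hb using fun μ => exists_hilbertBasis ℝ (Module.End.eigenspace (T : Module.End ℝ H) μ)
  have ho := hs.orthogonalFamily_eigenspaces.orthonormal_sigma_orthonormal
    (v_family := fun μ => ⇑(b μ)) fun μ => (b μ).orthonormal
  refine ⟨_, HilbertBasis.mkOfOrthogonalEqBot ho ?_, fun i : Sigma _ => i.1, fun i => ?_⟩
  · rw [Submodule.eq_bot_iff]
    intro x hx
    rw [← Submodule.mem_bot ℝ,
      ← ContinuousLinearMap.orthogonalComplement_iSup_eigenspaces_eq_bot hT hs,
      Submodule.mem_orthogonal']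
    rw [Submodule.mem_orthogonal'] at hx
    suffices h : (⨆ μ, Module.End.eigenspace (T : Module.End ℝ H) μ) ≤
        LinearMap.ker (innerSL ℝ x : H →ₗ[ℝ] ℝ) from fun y hy => h hy
    refine iSup_le fun μ y hy => ?_
    have h1 := ((b μ).hasSum_repr ⟨y, hy⟩).mapL
      ((innerSL ℝ x).comp (Module.End.eigenspace (T : Module.End ℝ H) μ).subtypeL)
    have h2 : ∀ i, ((innerSL ℝ x).comp (Module.End.eigenspace (T : Module.End ℝ H) μ).subtypeL)
        ((b μ).repr ⟨y, hy⟩ i • b μ i) = 0 := fun i => by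
      rw [map_smul]
      have : inner ℝ x (b μ i : H) = 0 := hx _ (Submodule.subset_span ⟨⟨μ, i⟩, rfl⟩)
      simp [this]
    simp only [h2] at h1
    exact h1.unique hasSum_zero
  · rw [HilbertBasis.coe_mkOfOrthogonalEqBot]
    exact Module.End.mem_eigenspace_iff.1 (b i.1 i.2).2

/-! ### Gaussian measures -/

variable [TopologicalSpace.SeparableSpace H] [MeasurableSpace H] [BorelSpace H]

lemma integral_cexp_sum_infinitePi_gaussianReal {ι : Type*} (v : ι → NNReal) (c : ι → ℝ)
    (s : Finset ι) :
    ∫ ω, Complex.exp (((∑ i ∈ s, ω i * c i : ℝ) : ℂ) * Complex.I)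
        ∂(Measure.infinitePi fun i => ProbabilityTheory.gaussianReal 0 (v i)) =
      Complex.exp (-((∑ i ∈ s, v i * c i ^ 2 : ℝ) : ℂ) / 2) := by
  have h1 : ∀ ω : ι → ℝ, Complex.exp (((∑ i ∈ s, ω i * c i : ℝ) : ℂ) * Complex.I) =
      (fun y : s → ℝ => ∏ i : s, Complex.exp ((c i : ℂ) * y i * Complex.I)) (s.restrict ω) := by
    intro ω
    simp only [Finset.restrict]
    rw [← Complex.exp_sum, Finset.univ_eq_attach,
      Finset.sum_attach s (fun i => (c i : ℂ) * ω i * Complex.I), ← Finset.sum_mul]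
    push_cast
    simp only [mul_comm]
  simp only [h1]
  refine (integral_restrict_infinitePi (μ := fun i => ProbabilityTheory.gaussianReal 0 (v i))
    (f := fun y : s → ℝ => ∏ i : s, Complex.exp ((c i : ℂ) * y i * Complex.I)) ?_).trans ?_
  · exact (Continuous.measurable (by fun_prop)).aestronglyMeasurable
  rw [integral_fintype_prod_eq_prod
    (fun (i : s) (y : ℝ) => Complex.exp ((c i : ℂ) * y * Complex.I))]
  simp only [← charFun_apply_real, ProbabilityTheory.charFun_gaussianReal]
  rw [← Complex.exp_sum, Finset.univ_eq_attach,
    Finset.sum_attach s (fun i => (c i : ℂ) * ((0 : ℝ) : ℂ) * Complex.I -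
      ((v i : ℝ) : ℂ) * (c i : ℂ) ^ 2 / 2)]
  congr 1
  push_cast
  rw [neg_div, Finset.sum_div, ← Finset.sum_neg_distrib]
  simp

lemma lintegral_sq_gaussianReal (v : NNReal) :
    ∫⁻ x, ENNReal.ofReal (x ^ 2) ∂(ProbabilityTheory.gaussianReal 0 v) = v := by
  have h1 := ProbabilityTheory.variance_id_gaussianReal (μ := 0) (v := v)
  have h2 : MemLp id 2 (ProbabilityTheory.gaussianReal 0 v) :=
    ProbabilityTheory.memLp_id_gaussianReal' 2 (by simp)
  rw [ProbabilityTheory.variance_eq_integral h2.1.aemeasurable] at h1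
  have h3 : ∫ x, x ∂(ProbabilityTheory.gaussianReal 0 v) = 0 :=
    ProbabilityTheory.integral_id_gaussianReal
  simp only [id_eq, h3, sub_zero] at h1
  have h4 := ofReal_integral_eq_lintegral_ofReal h2.integrable_sq
    (Eventually.of_forall fun x => sq_nonneg x)
  simp only [id_eq, h1] at h4
  rw [← h4]
  simp

/-- Gaussian measures with positive symmetric trace class covariance exist: in an eigenbasis of the
covariance, sum independent Gaussian coordinates with the eigenvalues as variances. -/
lemma exists_isCenteredGaussian {T : H → H} (hT : IsTraceClass T)
    (hs : ∀ x y, inner ℝ (T x) y = inner ℝ x (T y)) (hpos : ∀ x, 0 ≤ inner ℝ (T x) x) :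
    ∃ μ : Measure H, IsCenteredGaussian T μ := by
  obtain ⟨T', hc, hT'⟩ := hT.exists_compact
  obtain ⟨ι, e, l, hl⟩ := exists_eigenbasis hc (fun x y => by
    change inner ℝ (T' x) y = inner ℝ x (T' y)
    rw [hT', hT', hs])
  simp only [hT'] at hl
  have := countable_of_hilbertBasis e
  have hle : ∀ i, inner ℝ (T (e i)) (e i) = l i := fun i => by
    rw [hl, inner_smul_left, real_inner_self_eq_norm_sq, e.orthonormal.1]; simp
  have hl0 : ∀ i, 0 ≤ l i := fun i => hle i ▸ hpos (e i)
  have hls : Summable l := (hT.summable_inner e.orthonormal hpos).congr hle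
  let v : ι → NNReal := fun i => (l i).toNNReal
  have hv : ∀ i, (v i : ℝ) = l i := fun i => Real.coe_toNNReal _ (hl0 i)
  let P := Measure.infinitePi fun i => ProbabilityTheory.gaussianReal 0 (v i)
  -- almost every coordinate sequence is square summable
  have hsum : ∀ᵐ ω ∂P, HasSum (fun i => ω i • e i) (∑' i, ω i • e i) := by
    have h1 : ∫⁻ ω, ∑' i, ENNReal.ofReal (ω i ^ 2) ∂P ≠ ⊤ := by
      rw [lintegral_tsum fun i => Measurable.aemeasurable (by fun_prop)]
      have h2 : ∀ i, ∫⁻ ω, ENNReal.ofReal (ω i ^ 2) ∂P = ENNReal.ofReal (l i) := fun i => by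
        have h3 := (measurePreserving_eval_infinitePi
          (fun i => ProbabilityTheory.gaussianReal 0 (v i)) i).lintegral_comp
          (f := fun x => ENNReal.ofReal (x ^ 2)) (by fun_prop)
        refine h3.trans ?_
        rw [lintegral_sq_gaussianReal, ENNReal.ofReal]
      simp only [h2]
      rw [← ENNReal.ofReal_tsum_of_nonneg hl0 hls]
      exact ENNReal.ofReal_ne_top
    filter_upwards [ae_lt_top' (Measurable.aemeasurable (by fun_prop)) h1] with ω hω
    have h4 : Summable fun i => ω i ^ 2 := by
      have := ENNReal.summable_toReal hω.ne
      simpa only [ENNReal.toReal_ofReal (sq_nonneg _)] using this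
    have h5 : Memℓp (fun i => ω i) 2 := by
      refine memℓp_gen ?_
      simpa using h4
    exact (e.hasSum_repr_symm ⟨_, h5⟩).summable.hasSum
  have hmeas : AEMeasurable (fun ω : ι → ℝ => ∑' i, ω i • e i) P := by
    refine aemeasurable_of_tendsto_metrizable_ae (atTop : Filter (Finset ι))
      (f := fun s ω => ∑ i ∈ s, ω i • e i) (fun s => ?_) (hsum.mono fun ω hω => ?_)
    swap
    · simpa only [HasSum, SummationFilter.unconditional_filter] using hω
    have : SecondCountableTopology H := UniformSpace.secondCountable_of_separable H
    exact (Finset.measurable_fun_sum s fun i _ =>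
      (measurable_pi_apply i).smul_const (e i)).aemeasurable
  refine ⟨P.map fun ω => ∑' i, ω i • e i, Measure.isProbabilityMeasure_map hmeas, fun ξ => ?_⟩
  have hexp : Continuous fun y : H => Complex.exp ((inner ℝ y ξ : ℝ) * Complex.I) := by fun_prop
  rw [charFun_apply, integral_map hmeas hexp.aestronglyMeasurable]
  have hlim1 : Tendsto (fun s : Finset ι => ∫ ω, Complex.exp (((∑ i ∈ s, ω i * inner ℝ (e i) ξ : ℝ)
      : ℂ) * Complex.I) ∂P) atTop
      (𝓝 (∫ ω, Complex.exp ((inner ℝ (∑' i, ω i • e i) ξ : ℝ) * Complex.I) ∂P)) := by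
    refine tendsto_integral_filter_of_dominated_convergence (fun _ => 1)
      (Eventually.of_forall fun s => Measurable.aestronglyMeasurable (by fun_prop))
      (Eventually.of_forall fun s => Eventually.of_forall fun ω => ?_) (integrable_const _) ?_
    · rw [Complex.norm_exp_ofReal_mul_I]
    · filter_upwards [hsum] with ω hω
      have h1 : Tendsto (fun s : Finset ι => ∑ i ∈ s, ω i * inner ℝ (e i) ξ) atTop
          (𝓝 (inner ℝ (∑' i, ω i • e i) ξ)) := by
        have := hω.mapL (innerSL ℝ ξ)
        simp only [innerSL_apply_apply, inner_smul_right] at this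
        simpa only [HasSum, SummationFilter.unconditional_filter, real_inner_comm] using this
      have h2 : Continuous fun r : ℝ => Complex.exp (r * Complex.I) := by fun_prop
      exact (h2.tendsto _).comp h1
  have hlim2 : Tendsto (fun s : Finset ι => Complex.exp (-((∑ i ∈ s, v i * inner ℝ (e i) ξ ^ 2 : ℝ)
      : ℂ) / 2)) atTop (𝓝 (Complex.exp (-((inner ℝ (T ξ) ξ : ℝ) : ℂ) / 2))) := by
    have h1 : HasSum (fun i => v i * inner ℝ (e i) ξ ^ 2) (inner ℝ (T ξ) ξ) := by
      refine (e.hasSum_inner_mul_inner (T ξ) ξ).congr_fun fun i => ?_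
      rw [hs, hl, inner_smul_right, real_inner_comm ξ (e i), hv]
      ring
    have h2 : Continuous fun r : ℝ => Complex.exp (-(r : ℂ) / 2) := by fun_prop
    exact (h2.tendsto _).comp h1
  refine tendsto_nhds_unique hlim1 (hlim2.congr fun s => ?_)
  exact (integral_cexp_sum_infinitePi_gaussianReal v (fun i => inner ℝ (e i) ξ) s).symm

lemma IsCenteredGaussian.unique {T : H → H} {μ ν : Measure H} (hμ : IsCenteredGaussian T μ)
    (hν : IsCenteredGaussian T ν) : μ = ν := by
  have := hμ.1
  have := hν.1
  have : SecondCountableTopology H := UniformSpace.secondCountable_of_separable H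
  exact Measure.ext_of_charFun (funext fun ξ => by rw [hμ.2, hν.2])

lemma IsCenteredGaussian.map_inner {T : H → H} {μ : Measure H} (hμ : IsCenteredGaussian T μ)
    {ξ : H} (hT : ∀ r : ℝ, inner ℝ (T (r • ξ)) (r • ξ) = r ^ 2 * inner ℝ (T ξ) ξ)
    (hpos : 0 ≤ inner ℝ (T ξ) ξ) :
    μ.map (fun y => inner ℝ ξ y) =
      ProbabilityTheory.gaussianReal 0 (inner ℝ (T ξ) ξ).toNNReal := by
  have := hμ.1
  refine Measure.ext_of_charFun (funext fun r => ?_)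
  rw [charFun_apply_real, integral_map (Continuous.aemeasurable (by fun_prop))
    (Continuous.aestronglyMeasurable (by fun_prop)), ProbabilityTheory.charFun_gaussianReal]
  have h1 := hμ.2 (r • ξ)
  rw [charFun_apply, hT] at h1
  simp only [inner_smul_right, real_inner_comm ξ] at h1
  simp only [Complex.ofReal_mul] at h1
  simp only [real_inner_comm ξ] at h1 ⊢
  rw [h1]
  congr 1
  rw [real_inner_comm] at hpos
  rw [Real.coe_toNNReal _ hpos]
  push_cast
  ring

/-- The second moment of a centered Gaussian measure is the trace of its covariance. -/
lemma IsCenteredGaussian.lintegral_norm_sq {T : H → H} {μ : Measure H}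
    (hμ : IsCenteredGaussian T μ)
    (hT : ∀ (r : ℝ) (ξ : H), inner ℝ (T (r • ξ)) (r • ξ) = r ^ 2 * inner ℝ (T ξ) ξ)
    (hpos : ∀ x, 0 ≤ inner ℝ (T x) x) {ι : Type*} (e : HilbertBasis ι ℝ H) :
    ∫⁻ y, ENNReal.ofReal (‖y‖ ^ 2) ∂μ = ∑' i, ENNReal.ofReal (inner ℝ (T (e i)) (e i)) := by
  have := countable_of_hilbertBasis e
  have h1 : ∀ y, ENNReal.ofReal (‖y‖ ^ 2) = ∑' i, ENNReal.ofReal (inner ℝ (e i) y ^ 2) := by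
    intro y
    have h2 := e.hasSum_inner_mul_inner y y
    simp only [real_inner_comm _ y, ← sq, real_inner_self_eq_norm_sq] at h2
    rw [← ENNReal.ofReal_tsum_of_nonneg (fun i => sq_nonneg _) h2.summable, h2.tsum_eq]
  simp only [h1]
  rw [lintegral_tsum fun i => Measurable.aemeasurable (by fun_prop)]
  congr 1
  ext1 i
  have h2 := hμ.map_inner (fun r => hT r (e i)) (hpos (e i))
  have h3 := lintegral_sq_gaussianReal (inner ℝ (T (e i)) (e i)).toNNReal
  rw [← h2, lintegral_map (by fun_prop) (by fun_prop)] at h3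
  rw [h3, ENNReal.ofReal]

end GaussianMeasures

/-! ### Strongly continuous semigroups and the covariance operators -/

/-- Right-continuous functions are measurable: they are limits of their discretizations along
grids approaching from the right. -/
lemma measurable_of_continuousWithinAt_Ioi {f : ℝ → ℝ}
    (hf : ∀ t, ContinuousWithinAt f (Ioi t) t) : Measurable f := by
  refine measurable_of_tendsto_metrizable
    (f := fun (n : ℕ) t => f ((⌊((n : ℝ) + 1) * t⌋ + 1 : ℤ) / ((n : ℝ) + 1))) (fun n => ?_)
    (tendsto_pi_nhds.2 fun t => ?_)
  · exact (measurable_of_countable fun m : ℤ => f ((m + 1 : ℤ) / ((n : ℝ) + 1))).comp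
      (Int.measurable_floor.comp (by fun_prop : Measurable fun t : ℝ => ((n : ℝ) + 1) * t))
  · refine (hf t).tendsto.comp (tendsto_nhdsWithin_iff.2 ⟨?_, Eventually.of_forall fun n => ?_⟩)
    · have h1 : Tendsto (fun n : ℕ => t + 1 / ((n : ℝ) + 1)) atTop (𝓝 (t + 0)) :=
        tendsto_const_nhds.add tendsto_one_div_add_atTop_nhds_zero_nat
      rw [add_zero] at h1
      refine tendsto_of_tendsto_of_tendsto_of_le_of_le tendsto_const_nhds h1 (fun n => ?_)
        (fun n => ?_)
      · simp only
        rw [le_div_iff₀ (by positivity)]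
        push_cast
        linarith [Int.lt_floor_add_one (((n : ℝ) + 1) * t)]
      · simp only
        have h2 : (0 : ℝ) < n + 1 := by positivity
        rw [div_le_iff₀ h2, add_mul t, one_div, inv_mul_cancel₀ h2.ne']
        push_cast
        linarith [Int.floor_le (((n : ℝ) + 1) * t)]
    · rw [mem_Ioi, lt_div_iff₀ (by positivity)]
      push_cast
      linarith [Int.lt_floor_add_one (((n : ℝ) + 1) * t)]

/-- A function on `[0, ∞)` that is right-continuous, extended by its value at `0` to negative
arguments, is measurable. -/
lemma measurable_max_zero_of_right {f : ℝ → ℝ}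
    (hf : ∀ t, 0 ≤ t → Tendsto (fun h => f (t + h)) (𝓝[>] 0) (𝓝 (f t))) :
    Measurable fun t => f (max t 0) := by
  refine measurable_of_continuousWithinAt_Ioi fun t => ?_
  rcases lt_or_ge t 0 with ht | ht
  · refine (ContinuousAt.continuousWithinAt ?_)
    refine (continuousAt_const (y := f 0)).congr ?_
    filter_upwards [gt_mem_nhds ht] with s hs
    rw [max_eq_right (le_of_lt hs)]
  · have h1 : Tendsto (fun s => s - t) (𝓝[>] t) (𝓝[>] 0) := by
      refine tendsto_nhdsWithin_iff.2 ⟨?_, ?_⟩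
      · have : Continuous fun s : ℝ => s - t := by fun_prop
        simpa using (this.tendsto t).mono_left nhdsWithin_le_nhds
      · filter_upwards [self_mem_nhdsWithin] with s hs
        exact sub_pos.2 (mem_Ioi.1 hs)
    have h2 := (hf t ht).comp h1
    rw [ContinuousWithinAt, max_eq_left ht]
    refine h2.congr' ?_
    filter_upwards [self_mem_nhdsWithin] with s hs
    simp only [Function.comp, add_sub_cancel]
    rw [max_eq_left (ht.trans (le_of_lt hs))]

section Semigroup

variable [CompleteSpace H] {S : ℝ → H →L[ℝ] H} {Q : H →L[ℝ] H} {ω : ℝ}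

lemma IsC0Semigroup.tendsto_right (hS : IsC0Semigroup S) {t : ℝ} (ht : 0 ≤ t) (x : H) :
    Tendsto (fun h => S (t + h) x) (𝓝[>] 0) (𝓝 (S t x)) := by
  refine (((S t).continuous.tendsto x).comp (hS.tendsto x)).congr' ?_
  filter_upwards [self_mem_nhdsWithin] with h hh
  rw [hS.add t h ht (le_of_lt hh)]
  rfl

variable [TopologicalSpace.SeparableSpace H] [MeasurableSpace H] [BorelSpace H]

/-- Weakly measurable functions with values in a separable Hilbert space are measurable. -/
lemma measurable_of_forall_inner {α : Type*} [MeasurableSpace α] {f : α → H}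
    (hf : ∀ z, Measurable fun a => inner ℝ z (f a)) : Measurable f := by
  obtain ⟨w, e, -⟩ := exists_hilbertBasis ℝ H
  have := countable_of_hilbertBasis e
  have : SecondCountableTopology H := UniformSpace.secondCountable_of_separable H
  refine measurable_of_tendsto_metrizable' (atTop : Filter (Finset w))
    (f := fun s a => ∑ i ∈ s, inner ℝ (e i) (f a) • e i)
    (fun s => Finset.measurable_fun_sum s fun i _ => (hf (e i)).smul_const (e i))
    (tendsto_pi_nhds.2 fun a => ?_)
  simpa only [HasSum, SummationFilter.unconditional_filter, e.repr_apply_apply] using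
    e.hasSum_repr (f a)

lemma IsC0Semigroup.measurable_adjoint (hS : IsC0Semigroup S) (x : H) :
    Measurable fun s => ContinuousLinearMap.adjoint (S (max s 0)) x := by
  refine measurable_of_forall_inner fun z => ?_
  have : (fun s => inner ℝ z (ContinuousLinearMap.adjoint (S (max s 0)) x)) =
      fun s => inner ℝ (S (max s 0) z) x := by
    ext s; rw [ContinuousLinearMap.adjoint_inner_right]
  rw [this]
  exact measurable_max_zero_of_right (f := fun s => inner ℝ (S s z) x) fun t ht =>
    (hS.tendsto_right ht z).inner tendsto_const_nhds

lemma norm_semigroup_le (hω : ∀ t : ℝ, 0 ≤ t → ‖S t‖ ≤ Real.exp (ω * t)) {t s : ℝ} (hs : 0 ≤ s)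
    (hst : s ≤ t) : ‖S s‖ ≤ Real.exp (|ω| * t) := by
  refine (hω s hs).trans (Real.exp_le_exp.2 ?_)
  calc ω * s ≤ |ω| * s := by gcongr; exact le_abs_self ω
    _ ≤ |ω| * t := by gcongr

lemma norm_adjoint_semigroup_le (hω : ∀ t : ℝ, 0 ≤ t → ‖S t‖ ≤ Real.exp (ω * t)) {t s : ℝ}
    (hs : 0 ≤ s) (hst : s ≤ t) (x : H) :
    ‖ContinuousLinearMap.adjoint (S s) x‖ ≤ Real.exp (|ω| * t) * ‖x‖ := by
  refine (ContinuousLinearMap.le_opNorm _ _).trans ?_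
  rw [LinearIsometryEquiv.norm_map]
  gcongr
  exact norm_semigroup_le hω hs hst

lemma measurable_covIntegrand (hS : IsC0Semigroup S) (Q : H →L[ℝ] H) (x y : H) :
    Measurable fun s => inner ℝ (Q (ContinuousLinearMap.adjoint (S (max s 0)) x))
      (ContinuousLinearMap.adjoint (S (max s 0)) y) := by
  have : SecondCountableTopology H := UniformSpace.secondCountable_of_separable H
  exact (Q.continuous.measurable.comp (hS.measurable_adjoint x)).inner (hS.measurable_adjoint y)

lemma abs_covIntegrand_le (hω : ∀ t : ℝ, 0 ≤ t → ‖S t‖ ≤ Real.exp (ω * t)) (Q : H →L[ℝ] H)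
    {t s : ℝ} (hs : 0 ≤ s) (hst : s ≤ t) (x y : H) :
    |inner ℝ (Q (ContinuousLinearMap.adjoint (S s) x)) (ContinuousLinearMap.adjoint (S s) y)| ≤
      ‖Q‖ * (Real.exp (|ω| * t) * ‖x‖) * (Real.exp (|ω| * t) * ‖y‖) := by
  refine (abs_real_inner_le_norm _ _).trans ?_
  have h1 := norm_adjoint_semigroup_le hω hs hst x
  have h2 := norm_adjoint_semigroup_le hω hs hst y
  have h3 := (Q.le_opNorm (ContinuousLinearMap.adjoint (S s) x)).trans
    (mul_le_mul_of_nonneg_left h1 (norm_nonneg Q))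
  gcongr

lemma intervalIntegrable_covIntegrand (hS : IsC0Semigroup S)
    (hω : ∀ t : ℝ, 0 ≤ t → ‖S t‖ ≤ Real.exp (ω * t)) (Q : H →L[ℝ] H) {a b : ℝ} (ha : 0 ≤ a)
    (hb : 0 ≤ b) (x y : H) :
    IntervalIntegrable (fun s => inner ℝ (Q (ContinuousLinearMap.adjoint (S s) x))
      (ContinuousLinearMap.adjoint (S s) y)) volume a b := by
  have h0 : ∀ s ∈ uIoc a b, 0 ≤ s ∧ s ≤ max a b := fun s hs =>
    ⟨(le_min ha hb).trans hs.1.le, hs.2⟩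
  have h1 : IntervalIntegrable (fun s => inner ℝ (Q (ContinuousLinearMap.adjoint (S (max s 0)) x))
      (ContinuousLinearMap.adjoint (S (max s 0)) y)) volume a b := by
    refine (intervalIntegrable_const (c := ‖Q‖ * (Real.exp (|ω| * max a b) * ‖x‖) *
      (Real.exp (|ω| * max a b) * ‖y‖))).mono_fun'
      (measurable_covIntegrand hS Q x y).aestronglyMeasurable ?_
    filter_upwards [ae_restrict_mem measurableSet_uIoc] with s hs
    rw [max_eq_left (h0 s hs).1]
    exact abs_covIntegrand_le hω Q (h0 s hs).1 (h0 s hs).2 x y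
  refine h1.congr fun s hs => ?_
  rw [max_eq_left (h0 s hs).1]

/-- The quadratic form of `Q_t` is `∫₀ᵗ ⟨Q e^{sA*} x, e^{sA*} y⟩ ds`. -/
lemma inner_covOp (hS : IsC0Semigroup S) (hω : ∀ t : ℝ, 0 ≤ t → ‖S t‖ ≤ Real.exp (ω * t))
    (Q : H →L[ℝ] H) {t : ℝ} (ht : 0 ≤ t) (x y : H) :
    inner ℝ (covOp S Q t x) y = ∫ s in (0 : ℝ)..t,
      inner ℝ (Q (ContinuousLinearMap.adjoint (S s) x)) (ContinuousLinearMap.adjoint (S s) y) := by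
  have : SecondCountableTopology H := UniformSpace.secondCountable_of_separable H
  have hpos : ∀ s ∈ uIoc 0 t, 0 ≤ s ∧ s ≤ t := fun s hs => by
    rw [uIoc_of_le ht] at hs
    exact ⟨hs.1.le, hs.2⟩
  have hm : Measurable fun s => S (max s 0) (Q (ContinuousLinearMap.adjoint (S (max s 0)) x)) := by
    refine measurable_of_forall_inner fun z => ?_
    convert measurable_covIntegrand hS Q x z using 2 with s
    rw [← ContinuousLinearMap.adjoint_inner_left, real_inner_comm]
  have hi : IntervalIntegrable (fun s => S s (Q (ContinuousLinearMap.adjoint (S s) x)))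
      volume 0 t := by
    have h1 : IntervalIntegrable
        (fun s => S (max s 0) (Q (ContinuousLinearMap.adjoint (S (max s 0)) x))) volume 0 t := by
      refine (intervalIntegrable_const (c := Real.exp (|ω| * t) *
        (‖Q‖ * (Real.exp (|ω| * t) * ‖x‖)))).mono_fun' hm.aestronglyMeasurable ?_
      filter_upwards [ae_restrict_mem measurableSet_uIoc] with s hs
      rw [max_eq_left (hpos s hs).1]
      have h1 := norm_adjoint_semigroup_le hω (hpos s hs).1 (hpos s hs).2 x
      have h2 := (Q.le_opNorm (ContinuousLinearMap.adjoint (S s) x)).trans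
        (mul_le_mul_of_nonneg_left h1 (norm_nonneg Q))
      refine ((S s).le_opNorm _).trans ?_
      gcongr
      exact norm_semigroup_le hω (hpos s hs).1 (hpos s hs).2
    refine h1.congr fun s hs => ?_
    rw [max_eq_left (hpos s hs).1]
  rw [real_inner_comm, covOp, ← innerSL_apply_apply ℝ,
    ← ContinuousLinearMap.intervalIntegral_comp_comm _ hi]
  refine intervalIntegral.integral_congr fun s _ => ?_
  simp only [innerSL_apply_apply]
  rw [ContinuousLinearMap.adjoint_inner_right, real_inner_comm]

lemma inner_covOp_comm (hS : IsC0Semigroup S) (hω : ∀ t : ℝ, 0 ≤ t → ‖S t‖ ≤ Real.exp (ω * t))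
    (hQ : Q.IsPositive) {t : ℝ} (ht : 0 ≤ t) (x y : H) :
    inner ℝ (covOp S Q t x) y = inner ℝ x (covOp S Q t y) := by
  rw [real_inner_comm (covOp S Q t y) x, inner_covOp hS hω Q ht, inner_covOp hS hω Q ht]
  refine intervalIntegral.integral_congr fun s _ => ?_
  rw [real_inner_comm (ContinuousLinearMap.adjoint (S s) x)]
  exact hQ.isSymmetric _ _

lemma inner_covOp_nonneg (hS : IsC0Semigroup S) (hω : ∀ t : ℝ, 0 ≤ t → ‖S t‖ ≤ Real.exp (ω * t))
    (hQ : Q.IsPositive) {t : ℝ} (ht : 0 ≤ t) (x : H) : 0 ≤ inner ℝ (covOp S Q t x) x := by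
  rw [inner_covOp hS hω Q ht]
  exact intervalIntegral.integral_nonneg ht fun s _ => hQ.inner_nonneg_left _

lemma inner_covOp_smul (hS : IsC0Semigroup S) (hω : ∀ t : ℝ, 0 ≤ t → ‖S t‖ ≤ Real.exp (ω * t))
    (Q : H →L[ℝ] H) {t : ℝ} (ht : 0 ≤ t) (r : ℝ) (x : H) :
    inner ℝ (covOp S Q t (r • x)) (r • x) = r ^ 2 * inner ℝ (covOp S Q t x) x := by
  rw [inner_covOp hS hω Q ht, inner_covOp hS hω Q ht, ← intervalIntegral.integral_const_mul]
  refine intervalIntegral.integral_congr fun s _ => ?_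
  simp only [map_smul, inner_smul_left, inner_smul_right]
  simp
  ring

/-- The cocycle property `Q_{t+s} = Q_t + e^{tA} Q_s e^{tA*}`. -/
lemma inner_covOp_add (hS : IsC0Semigroup S) (hω : ∀ t : ℝ, 0 ≤ t → ‖S t‖ ≤ Real.exp (ω * t))
    (Q : H →L[ℝ] H) {t s : ℝ} (ht : 0 ≤ t) (hs : 0 ≤ s) (x : H) :
    inner ℝ (covOp S Q (t + s) x) x = inner ℝ (covOp S Q t x) x +
      inner ℝ (covOp S Q s (ContinuousLinearMap.adjoint (S t) x))
        (ContinuousLinearMap.adjoint (S t) x) := by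
  have hts : 0 ≤ t + s := add_nonneg ht hs
  rw [inner_covOp hS hω Q hts, inner_covOp hS hω Q ht, inner_covOp hS hω Q hs,
    ← intervalIntegral.integral_add_adjacent_intervals (b := t)
      (intervalIntegrable_covIntegrand hS hω Q le_rfl ht x x)
      (intervalIntegrable_covIntegrand hS hω Q ht hts x x)]
  congr 1
  have h1 := intervalIntegral.integral_comp_add_left (a := 0) (b := s) (fun s => inner ℝ
    (Q (ContinuousLinearMap.adjoint (S s) x)) (ContinuousLinearMap.adjoint (S s) x)) t
  rw [add_zero] at h1
  rw [← h1]
  refine intervalIntegral.integral_congr fun r hr => ?_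
  rw [uIcc_of_le hs] at hr
  rw [hS.add t r ht hr.1, ContinuousLinearMap.adjoint_comp]
  rfl

/-- The trace of `Q_t` tends to `0` with `t`. -/
lemma tendsto_trace_covOp (hS : IsC0Semigroup S)
    (hω : ∀ t : ℝ, 0 ≤ t → ‖S t‖ ≤ Real.exp (ω * t)) (hQ : Q.IsPositive)
    (h1 : IsTraceClass (covOp S Q 1)) {ι : Type*} (e : HilbertBasis ι ℝ H) :
    Tendsto (fun t => ∑' i, inner ℝ (covOp S Q t (e i)) (e i)) (𝓝[>] 0) (𝓝 0) := by
  have hs := h1.summable_inner e.orthonormal (inner_covOp_nonneg hS hω hQ zero_le_one)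
  have hIoc : ∀ᶠ t : ℝ in 𝓝[>] 0, t ∈ Ioc (0 : ℝ) 1 := Ioc_mem_nhdsGT one_pos
  have := tendsto_tsum_of_dominated_convergence (𝓕 := 𝓝[>] (0 : ℝ))
    (f := fun t i => inner ℝ (covOp S Q t (e i)) (e i)) (g := fun _ => (0 : ℝ)) hs (fun i => ?_) ?_
  · simpa using this
  · set C := ‖Q‖ * (Real.exp (|ω| * 1) * ‖e i‖) * (Real.exp (|ω| * 1) * ‖e i‖) with hC
    have hlim : Tendsto (fun t : ℝ => C * |t - 0|) (𝓝[>] 0) (𝓝 0) := by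
      have h2 : Continuous fun t : ℝ => C * |t - 0| := by fun_prop
      simpa using (h2.tendsto 0).mono_left nhdsWithin_le_nhds
    refine squeeze_zero_norm' ?_ hlim
    filter_upwards [hIoc] with t ht
    rw [inner_covOp hS hω Q ht.1.le]
    refine intervalIntegral.norm_integral_le_of_norm_le_const fun s hs => ?_
    rw [uIoc_of_le ht.1.le] at hs
    exact abs_covIntegrand_le hω Q hs.1.le (hs.2.trans ht.2) _ _
  · filter_upwards [hIoc] with t ht i
    rw [Real.norm_of_nonneg (inner_covOp_nonneg hS hω hQ ht.1.le _)]
    have h2 := inner_covOp_add hS hω Q ht.1.le (sub_nonneg.2 ht.2) (e i)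
    rw [add_sub_cancel] at h2
    rw [h2]
    exact le_add_of_nonneg_right (inner_covOp_nonneg hS hω hQ (sub_nonneg.2 ht.2) _)

end Semigroup

/-! ### The Ornstein-Uhlenbeck semigroup -/

/-- The modulus of continuity of `φ` is dominated by `δ + M |y|²`, so that averages of `φ` over
small displacements are controlled by their second moments. -/
lemma Cb.exists_abs_sub_le_sq (φ : Cb H) {δ : ℝ} (hδ : 0 < δ) :
    ∃ M, 0 ≤ M ∧ ∀ z y, |φ (z + y) - φ z| ≤ δ + M * ‖y‖ ^ 2 := by
  obtain ⟨r, hr, H1⟩ := Metric.uniformContinuous_iff.1 φ.uniformContinuous δ hδ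
  refine ⟨2 * ‖φ‖ / r ^ 2, by positivity, fun z y => ?_⟩
  have h0 : 0 ≤ 2 * ‖φ‖ / r ^ 2 * ‖y‖ ^ 2 := by positivity
  rcases lt_or_ge ‖y‖ r with hy | hy
  · have := H1 (show dist (z + y) z < r by simpa [dist_eq_norm] using hy)
    rw [Real.dist_eq] at this
    linarith
  · have h1 : 2 * ‖φ‖ ≤ 2 * ‖φ‖ / r ^ 2 * ‖y‖ ^ 2 := by
      rw [div_mul_eq_mul_div, le_div_iff₀ (by positivity)]
      gcongr
    have h2 := abs_le.1 (φ.abs_le_norm (z + y))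
    have h3 := abs_le.1 (φ.abs_le_norm z)
    rw [abs_le]
    constructor <;> linarith

/-- Averages of uniformly continuous functions with an integrable bound are uniformly
continuous. -/
lemma uniformContinuous_integral {α : Type*} [MeasurableSpace α] {μ : Measure α} {f : α → H → ℝ}
    {b : α → ℝ} (hm : ∀ x, AEStronglyMeasurable (fun a => f a x) μ)
    (hb : ∀ᵐ a ∂μ, ∀ x, |f a x| ≤ b a) (hbi : Integrable b μ)
    (hu : ∀ a, UniformContinuous (f a)) : UniformContinuous fun x => ∫ a, f a x ∂μ := by
  have hi : ∀ x, Integrable (fun a => f a x) μ := fun x =>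
    hbi.mono' (hm x) (hb.mono fun a ha => ha x)
  have h1 : Tendsto (fun p : H × H => ∫ a, (f a p.1 - f a p.2) ∂μ) (uniformity H) (𝓝 0) := by
    have := tendsto_integral_filter_of_dominated_convergence (l := uniformity H) (μ := μ)
      (F := fun (p : H × H) a => f a p.1 - f a p.2) (f := fun _ => (0 : ℝ)) (fun a => b a + b a)
      (Eventually.of_forall fun p => (hm p.1).sub (hm p.2))
      (Eventually.of_forall fun p => hb.mono fun a ha => (abs_sub _ _).trans
        (add_le_add (ha _) (ha _))) (hbi.add hbi)
      (Eventually.of_forall fun a => ?_)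
    · simpa using this
    · rw [Metric.tendsto_nhds]
      intro e he
      obtain ⟨r, hr, H1⟩ := Metric.uniformContinuous_iff.1 (hu a) e he
      filter_upwards [Metric.dist_mem_uniformity hr] with p hp
      rw [dist_zero_right, ← dist_eq_norm]
      exact H1 hp
  rw [Metric.uniformContinuous_iff]
  intro e he
  have h2 := Metric.tendsto_nhds.1 h1 e he
  obtain ⟨r, hr, H1⟩ := Metric.mem_uniformity_dist.1 h2
  refine ⟨r, hr, fun x y hxy => ?_⟩
  have := H1 hxy
  rw [mem_ofPred_eq] at this
  simp only [dist_zero_right] at this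
  rwa [integral_sub (hi x) (hi y), ← dist_eq_norm] at this

section OU

variable [CompleteSpace H] [MeasurableSpace H] [BorelSpace H]

/-- The standing assumptions on the Ornstein-Uhlenbeck semigroup: `S` is a strongly continuous
semigroup of exponential type `ω`, and `Q` is positive with trace class covariances `Q_t`. -/
structure OUSetting (S : ℝ → H →L[ℝ] H) (Q : H →L[ℝ] H) (ω : ℝ) : Prop where
  semigroup : IsC0Semigroup S
  norm_le : ∀ t : ℝ, 0 ≤ t → ‖S t‖ ≤ Real.exp (ω * t)
  isPositive : Q.IsPositive
  isTraceClass : ∀ t : ℝ, 0 < t → IsTraceClass (covOp S Q t)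

/-- `R_t φ` as an element of `C_b(H)`. -/
def ouCb (S : ℝ → H →L[ℝ] H) (Q : H →L[ℝ] H) (t : ℝ) (φ : Cb H) : Cb H :=
  have hu : UniformContinuous (ouSemigroup S Q t φ) :=
    uniformContinuous_integral (b := fun _ => ‖φ‖)
      (fun x => (integrable_shift φ (S t x) (covOp S Q t)).1)
      (Eventually.of_forall fun _ _ => φ.abs_le_norm _) (integrable_const _)
      fun _ => φ.uniformContinuous.comp ((S t).uniformContinuous.add uniformContinuous_const)
  ⟨BoundedContinuousFunction.ofNormedAddCommGroup (ouSemigroup S Q t φ) hu.continuous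
    (‖φ‖ * (gaussian (covOp S Q t)).real univ) fun _ =>
      norm_integral_le_of_norm_le_const (Eventually.of_forall fun _ => φ.abs_le_norm _), hu⟩

lemma ouCb_apply (S : ℝ → H →L[ℝ] H) (Q : H →L[ℝ] H) (t : ℝ) (φ : Cb H) (x : H) :
    ouCb S Q t φ x = ouSemigroup S Q t φ x := rfl

variable [TopologicalSpace.SeparableSpace H] {S : ℝ → H →L[ℝ] H} {Q : H →L[ℝ] H} {ω : ℝ}

namespace OUSetting

lemma isCenteredGaussian (h : OUSetting S Q ω) {t : ℝ} (ht : 0 ≤ t) :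
    IsCenteredGaussian (covOp S Q t) (gaussian (covOp S Q t)) := by
  have hT : IsTraceClass (covOp S Q t) := by
    rcases ht.eq_or_lt with rfl | ht
    · exact ⟨fun _ => 0, fun _ => 0, by simp, fun x => by simp [covOp]⟩
    · exact h.isTraceClass t ht
  have hex := exists_isCenteredGaussian hT
    (inner_covOp_comm h.semigroup h.norm_le h.isPositive ht)
    (inner_covOp_nonneg h.semigroup h.norm_le h.isPositive ht)
  rw [gaussian, dif_pos hex]
  exact hex.choose_spec

lemma isProbabilityMeasure (h : OUSetting S Q ω) {t : ℝ} (ht : 0 ≤ t) :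
    IsProbabilityMeasure (gaussian (covOp S Q t)) := (h.isCenteredGaussian ht).1

lemma abs_integral_le (h : OUSetting S Q ω) {t : ℝ} (ht : 0 ≤ t) {f : H → ℝ} {C : ℝ}
    (hf : ∀ y, |f y| ≤ C) : |∫ y, f y ∂(gaussian (covOp S Q t))| ≤ C := by
  have := h.isProbabilityMeasure ht
  simpa using norm_integral_le_of_norm_le_const (μ := gaussian (covOp S Q t))
    (f := f) (Eventually.of_forall hf)

lemma abs_ouSemigroup_le (h : OUSetting S Q ω) {t : ℝ} (ht : 0 ≤ t) (φ : Cb H) (x : H) :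
    |ouSemigroup S Q t φ x| ≤ ‖φ‖ := h.abs_integral_le ht fun _ => φ.abs_le_norm _

/-- `N_{Q_{s+t}}` is the law of `e^{sA} Y + Y'` for independent `Y ∼ N_{Q_t}` and
`Y' ∼ N_{Q_s}`. -/
lemma gaussian_add (h : OUSetting S Q ω) {s t : ℝ} (hs : 0 ≤ s) (ht : 0 ≤ t) :
    gaussian (covOp S Q (s + t)) =
      ((gaussian (covOp S Q t)).prod (gaussian (covOp S Q s))).map fun p => S s p.1 + p.2 := by
  have : SecondCountableTopology H := UniformSpace.secondCountable_of_separable H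
  have := h.isProbabilityMeasure hs
  have := h.isProbabilityMeasure ht
  have hm : Measurable fun p : H × H => S s p.1 + p.2 := by fun_prop
  refine (h.isCenteredGaussian (add_nonneg hs ht)).unique
    ⟨Measure.isProbabilityMeasure_map hm.aemeasurable, fun ξ => ?_⟩
  have hexp : Continuous fun y : H => Complex.exp ((inner ℝ y ξ : ℝ) * Complex.I) := by fun_prop
  rw [charFun_apply, integral_map hm.aemeasurable hexp.aestronglyMeasurable]
  have h1 : ∀ p : H × H, Complex.exp ((inner ℝ (S s p.1 + p.2) ξ : ℝ) * Complex.I) =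
      Complex.exp ((inner ℝ p.1 (ContinuousLinearMap.adjoint (S s) ξ) : ℝ) * Complex.I) *
        Complex.exp ((inner ℝ p.2 ξ : ℝ) * Complex.I) := fun p => by
    rw [← Complex.exp_add, inner_add_left, ContinuousLinearMap.adjoint_inner_right]
    push_cast
    rw [add_mul]
  simp only [h1]
  rw [integral_prod_mul
    (f := fun y => Complex.exp ((inner ℝ y (ContinuousLinearMap.adjoint (S s) ξ) : ℝ) * Complex.I))
    (g := fun y => Complex.exp ((inner ℝ y ξ : ℝ) * Complex.I)), ← charFun_apply, ← charFun_apply,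
    (h.isCenteredGaussian hs).2, (h.isCenteredGaussian ht).2, ← Complex.exp_add,
    inner_covOp_add h.semigroup h.norm_le Q hs ht]
  congr 1
  push_cast
  ring

/-- The semigroup law. -/
lemma ouSemigroup_add_time (h : OUSetting S Q ω) {s t : ℝ} (hs : 0 ≤ s) (ht : 0 ≤ t) (φ : Cb H)
    (x : H) : ouSemigroup S Q (s + t) φ x = ouSemigroup S Q t (ouCb S Q s φ) x := by
  have : SecondCountableTopology H := UniformSpace.secondCountable_of_separable H
  have hφ := φ.uniformContinuous.continuous
  have h1 : Measurable fun p : H × H => S s p.1 + p.2 := by fun_prop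
  have h2 : Continuous fun p : H × H => φ (S (s + t) x + (S s p.1 + p.2)) := by fun_prop
  have h3 : Continuous fun y : H => φ (S (s + t) x + y) := by fun_prop
  rw [ouSemigroup, h.gaussian_add hs ht, integral_map h1.aemeasurable h3.aestronglyMeasurable,
    integral_prod]
  · rw [ouSemigroup]
    congr 1
    ext y
    rw [ouCb_apply, ouSemigroup]
    congr 1
    ext z
    have e : S (s + t) x + (S s y + z) = S s (S t x + y) + z := by
      rw [h.semigroup.add s t hs ht, map_add, add_assoc]
      rfl
    exact congrArg _ e
  · exact (integrable_const ‖φ‖).mono' h2.aestronglyMeasurable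
      (Eventually.of_forall fun p => φ.abs_le_norm _)

/-- `R_t φ (x)` is uniformly close to `φ (e^{tA} x)` when the trace of `Q_t` is small. -/
lemma abs_ouSemigroup_sub_le (h : OUSetting S Q ω) {t : ℝ} (ht : 0 < t) {φ : Cb H} {δ M : ℝ}
    (hM : ∀ z y, |φ (z + y) - φ z| ≤ δ + M * ‖y‖ ^ 2) {ι : Type*} (e : HilbertBasis ι ℝ H)
    (x : H) :
    |ouSemigroup S Q t φ x - φ (S t x)| ≤
      δ + M * ∑' i, inner ℝ (covOp S Q t (e i)) (e i) := by
  have hpr := h.isProbabilityMeasure ht.le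
  have hpos := inner_covOp_nonneg h.semigroup h.norm_le h.isPositive ht.le
  have hsum := (h.isTraceClass t ht).summable_inner e.orthonormal hpos
  have h1 := (h.isCenteredGaussian ht.le).lintegral_norm_sq
    (inner_covOp_smul h.semigroup h.norm_le Q ht.le) hpos e
  rw [← ENNReal.ofReal_tsum_of_nonneg (fun i => hpos _) hsum] at h1
  have hc : Continuous fun y : H => ‖y‖ ^ 2 := by fun_prop
  have hi : Integrable (fun y : H => ‖y‖ ^ 2) (gaussian (covOp S Q t)) := by
    refine ⟨hc.aestronglyMeasurable, ?_⟩
    rw [hasFiniteIntegral_iff_ofReal (Eventually.of_forall fun y => sq_nonneg _), h1]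
    exact ENNReal.ofReal_lt_top
  have h2 : ∫ y, ‖y‖ ^ 2 ∂(gaussian (covOp S Q t)) =
      ∑' i, inner ℝ (covOp S Q t (e i)) (e i) := by
    rw [integral_eq_lintegral_of_nonneg_ae (Eventually.of_forall fun y => sq_nonneg _) hi.1, h1,
      ENNReal.toReal_ofReal (tsum_nonneg fun i => hpos _)]
  have h3 : ouSemigroup S Q t φ x - φ (S t x) =
      ∫ y, (φ (S t x + y) - φ (S t x)) ∂(gaussian (covOp S Q t)) := by
    rw [integral_sub (integrable_shift φ _ _) (integrable_const _)]
    simp [ouSemigroup]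
  rw [h3, ← Real.norm_eq_abs]
  refine (norm_integral_le_of_norm_le ((integrable_const δ).add (hi.const_mul M))
    (Eventually.of_forall fun y => hM (S t x) y)).trans_eq ?_
  simp only [Pi.add_apply]
  rw [integral_add (integrable_const δ) (hi.const_mul M), integral_const_mul, h2]
  simp

lemma tendsto_ouSemigroup_zero (h : OUSetting S Q ω) (φ : Cb H) (x : H) :
    Tendsto (fun t => ouSemigroup S Q t φ x) (𝓝[>] 0) (𝓝 (φ x)) := by
  obtain ⟨w, e, -⟩ := exists_hilbertBasis ℝ H
  have htr := tendsto_trace_covOp h.semigroup h.norm_le h.isPositive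
    (h.isTraceClass 1 one_pos) e
  have h1 : Tendsto (fun t => φ (S t x)) (𝓝[>] 0) (𝓝 (φ x)) :=
    (φ.uniformContinuous.continuous.tendsto x).comp (h.semigroup.tendsto x)
  have h2 : Tendsto (fun t => ouSemigroup S Q t φ x - φ (S t x)) (𝓝[>] 0) (𝓝 0) := by
    rw [Metric.tendsto_nhds]
    intro ε hε
    obtain ⟨M, hM0, hM⟩ := φ.exists_abs_sub_le_sq (δ := ε / 2) (by positivity)
    have h3 := (htr.const_mul M).eventually (gt_mem_nhds (show M * 0 < ε / 2 by
      rw [mul_zero]; positivity))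
    filter_upwards [h3, self_mem_nhdsWithin] with t ht1 ht2
    rw [dist_zero_right, Real.norm_eq_abs]
    exact (h.abs_ouSemigroup_sub_le ht2 hM e x).trans_lt (by linarith)
  simpa using h2.add h1

lemma tendsto_ouSemigroup_right (h : OUSetting S Q ω) {t : ℝ} (ht : 0 ≤ t) (φ : Cb H) (x : H) :
    Tendsto (fun s => ouSemigroup S Q (t + s) φ x) (𝓝[>] 0) (𝓝 (ouSemigroup S Q t φ x)) := by
  have h1 : Tendsto (fun s => ouSemigroup S Q t (ouCb S Q s φ) x) (𝓝[>] 0)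
      (𝓝 (ouSemigroup S Q t φ x)) := by
    refine tendsto_integral_filter_of_dominated_convergence (fun _ => ‖φ‖)
      (Eventually.of_forall fun s => (integrable_shift (ouCb S Q s φ) _ _).1) ?_
      (integrable_const _) (Eventually.of_forall fun y => h.tendsto_ouSemigroup_zero φ _)
    filter_upwards [self_mem_nhdsWithin] with s hs
    exact Eventually.of_forall fun y => h.abs_ouSemigroup_le (le_of_lt hs) φ _
  refine h1.congr' ?_
  filter_upwards [self_mem_nhdsWithin] with s hs
  rw [add_comm, h.ouSemigroup_add_time (le_of_lt hs) ht]

lemma ouSemigroup_zero_time (h : OUSetting S Q ω) (φ : Cb H) (x : H) :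
    ouSemigroup S Q 0 φ x = φ x := by
  have := h.tendsto_ouSemigroup_right le_rfl φ x
  simp only [zero_add] at this
  exact tendsto_nhds_unique this (h.tendsto_ouSemigroup_zero φ x)

lemma measurable_ouSemigroup (h : OUSetting S Q ω) (φ : Cb H) (x : H) :
    Measurable fun t => ouSemigroup S Q (max t 0) φ x :=
  measurable_max_zero_of_right fun _ ht => h.tendsto_ouSemigroup_right ht φ x

end OUSetting

end OU

/-! ### The resolvent of the Ornstein-Uhlenbeck operator -/

section Resolvent

variable [CompleteSpace H] [MeasurableSpace H] [BorelSpace H]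

/-- The integrand `e^{-lt} R_t φ(x)` of the Laplace transform of the Ornstein-Uhlenbeck semigroup;
`t` is truncated at `0` so as to be measurable on the whole line. -/
def ouLaplaceDensity (S : ℝ → H →L[ℝ] H) (Q : H →L[ℝ] H) (l : ℝ) (φ : Cb H) (t : ℝ) (x : H) : ℝ :=
  Real.exp (-l * t) * ouSemigroup S Q (max t 0) φ x

variable [TopologicalSpace.SeparableSpace H] {S : ℝ → H →L[ℝ] H} {Q : H →L[ℝ] H} {ω : ℝ}

namespace OUSetting

lemma measurable_ouLaplaceDensity (h : OUSetting S Q ω) (l : ℝ) (φ : Cb H) (x : H) :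
    Measurable fun t => ouLaplaceDensity S Q l φ t x :=
  (by fun_prop : Measurable fun t : ℝ => Real.exp (-l * t)).mul (h.measurable_ouSemigroup φ x)

lemma abs_ouLaplaceDensity_le (h : OUSetting S Q ω) (l : ℝ) (φ : Cb H) (t : ℝ) (x : H) :
    |ouLaplaceDensity S Q l φ t x| ≤ Real.exp (-l * t) * ‖φ‖ := by
  rw [ouLaplaceDensity, abs_mul, abs_of_pos (Real.exp_pos _)]
  gcongr
  exact h.abs_ouSemigroup_le (le_max_right _ _) φ x

lemma integrableOn_exp (φ : Cb H) {l : ℝ} (hl : 0 < l) :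
    IntegrableOn (fun t => Real.exp (-l * t) * ‖φ‖) (Ioi 0) :=
  (integrableOn_exp_mul_Ioi (neg_lt_zero.2 hl) 0).mul_const _

lemma integrableOn_ouLaplaceDensity (h : OUSetting S Q ω) {l : ℝ} (hl : 0 < l) (φ : Cb H) (x : H) :
    IntegrableOn (fun t => ouLaplaceDensity S Q l φ t x) (Ioi 0) :=
  (integrableOn_exp φ hl).mono' (h.measurable_ouLaplaceDensity l φ x).aestronglyMeasurable
    (Eventually.of_forall fun t => h.abs_ouLaplaceDensity_le l φ t x)

lemma abs_integral_ouLaplaceDensity_le (h : OUSetting S Q ω) {l : ℝ} (hl : 0 < l) (φ : Cb H)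
    (x : H) : |∫ t in Ioi 0, ouLaplaceDensity S Q l φ t x| ≤ l⁻¹ * ‖φ‖ := by
  refine (norm_integral_le_of_norm_le (f := fun t => ouLaplaceDensity S Q l φ t x)
    (integrableOn_exp φ hl)
    (Eventually.of_forall fun t => h.abs_ouLaplaceDensity_le l φ t x)).trans_eq ?_
  rw [integral_mul_const, integral_exp_mul_Ioi (neg_lt_zero.2 hl)]
  simp

/-- The resolvent `φ ↦ ∫₀^∞ e^{-lt} R_t φ dt` of the Ornstein-Uhlenbeck operator. -/
def resolvent (h : OUSetting S Q ω) {l : ℝ} (hl : 0 < l) : Cb H →L[ℝ] Cb H :=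
  LinearMap.mkContinuous
    { toFun := fun φ =>
        have hu : UniformContinuous fun x => ∫ t in Ioi 0, ouLaplaceDensity S Q l φ t x :=
          uniformContinuous_integral
            (fun x => (h.measurable_ouLaplaceDensity l φ x).aestronglyMeasurable)
            (Eventually.of_forall fun t x => h.abs_ouLaplaceDensity_le l φ t x)
            (integrableOn_exp φ hl)
            fun t => (ouCb S Q (max t 0) φ).uniformContinuous.const_smul (Real.exp (-l * t))
        ⟨BoundedContinuousFunction.ofNormedAddCommGroup _ hu.continuous _
          (h.abs_integral_ouLaplaceDensity_le hl φ), hu⟩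
      map_add' := fun φ ψ => Cb.ext fun x => by
        change ∫ t in Ioi 0, ouLaplaceDensity S Q l (φ + ψ) t x =
          (∫ t in Ioi 0, ouLaplaceDensity S Q l φ t x) + ∫ t in Ioi 0, ouLaplaceDensity S Q l ψ t x
        rw [← integral_add (h.integrableOn_ouLaplaceDensity hl φ x)
          (h.integrableOn_ouLaplaceDensity hl ψ x)]
        simp only [ouLaplaceDensity, ouSemigroup_add, mul_add]
      map_smul' := fun c φ => Cb.ext fun x => by
        change ∫ t in Ioi 0, ouLaplaceDensity S Q l (c • φ) t x =
          c * ∫ t in Ioi 0, ouLaplaceDensity S Q l φ t x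
        rw [← integral_const_mul]
        simp only [ouLaplaceDensity, ouSemigroup_smul]
        congr 1
        ext t
        ring }
    l⁻¹ fun φ => Cb.norm_le (by positivity) (h.abs_integral_ouLaplaceDensity_le hl φ)

lemma resolvent_apply (h : OUSetting S Q ω) {l : ℝ} (hl : 0 < l) (φ : Cb H) (x : H) :
    h.resolvent hl φ x = ∫ t in Ioi 0, ouLaplaceDensity S Q l φ t x := rfl

lemma norm_resolvent_le (h : OUSetting S Q ω) {l : ℝ} (hl : 0 < l) : ‖h.resolvent hl‖ ≤ l⁻¹ :=
  LinearMap.mkContinuous_norm_le _ (by positivity) _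

/-- By Fubini's theorem and the semigroup law, `R_s` acts on the resolvent by a shift in time. -/
lemma ouSemigroup_resolvent (h : OUSetting S Q ω) {l : ℝ} (hl : 0 < l) (φ : Cb H) {s : ℝ}
    (hs : 0 ≤ s) (x : H) :
    ouSemigroup S Q s (h.resolvent hl φ) x =
      Real.exp (l * s) *
        (h.resolvent hl φ x - ∫ t in (0 : ℝ)..s, ouLaplaceDensity S Q l φ t x) := by
  have : SecondCountableTopology H := UniformSpace.secondCountable_of_separable H
  have := h.isProbabilityMeasure hs
  have hi := h.integrableOn_ouLaplaceDensity hl φ x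
  have h1 : ouSemigroup S Q s (h.resolvent hl φ) x =
      ∫ t in Ioi 0, ∫ y, ouLaplaceDensity S Q l φ t (S s x + y) ∂(gaussian (covOp S Q s)) := by
    rw [ouSemigroup]
    simp only [resolvent_apply]
    refine integral_integral_swap (f := fun y t => ouLaplaceDensity S Q l φ t (S s x + y)) ?_
    refine ((integrableOn_exp φ hl).comp_snd _).mono' ?_
      (Eventually.of_forall fun p => h.abs_ouLaplaceDensity_le l φ p.2 _)
    refine (measurable_uncurry_of_continuous_of_measurable (fun t => ?_) fun y =>
      h.measurable_ouLaplaceDensity l φ _).aestronglyMeasurable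
    have := (ouCb S Q (max t 0) φ).uniformContinuous.continuous
    exact continuous_const.mul (this.comp (continuous_const.add continuous_id))
  have h2 : ∀ t ∈ Ioi (0 : ℝ), ∫ y, ouLaplaceDensity S Q l φ t (S s x + y) ∂(gaussian (covOp S Q s))
      = Real.exp (l * s) * ouLaplaceDensity S Q l φ (t + s) x := by
    intro t ht
    have ht : 0 < t := ht
    have h3 : ouSemigroup S Q (t + s) φ x =
        ∫ y, ouSemigroup S Q t φ (S s x + y) ∂(gaussian (covOp S Q s)) :=
      h.ouSemigroup_add_time ht.le hs φ x
    simp only [ouLaplaceDensity]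
    rw [integral_const_mul, max_eq_left ht.le, max_eq_left (by positivity), h3, ← mul_assoc,
      ← Real.exp_add]
    congr 2
    ring
  rw [h1, setIntegral_congr_fun measurableSet_Ioi h2, integral_const_mul]
  congr 1
  have h4 := (measurePreserving_add_right volume s).setIntegral_preimage_emb
    (measurableEmbedding_addRight s) (fun t => ouLaplaceDensity S Q l φ t x) (Ioi s)
  rw [show (fun t : ℝ => t + s) ⁻¹' Ioi s = Ioi 0 by ext; simp] at h4
  rw [h4, resolvent_apply, ← intervalIntegral.integral_Ioi_sub_Ioi hi hs, sub_sub_cancel]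

lemma tendsto_ouLaplaceDensity_zero (h : OUSetting S Q ω) (l : ℝ) (φ : Cb H) (x : H) :
    Tendsto (fun t => ouLaplaceDensity S Q l φ t x) (𝓝[>] 0) (𝓝 (φ x)) := by
  have h1 : Tendsto (fun t : ℝ => Real.exp (-l * t)) (𝓝[>] 0) (𝓝 1) := by
    have : Continuous fun t : ℝ => Real.exp (-l * t) := by fun_prop
    simpa using (this.tendsto 0).mono_left nhdsWithin_le_nhds
  have h2 := h1.mul (h.tendsto_ouSemigroup_zero φ x)
  rw [one_mul] at h2
  refine h2.congr' ?_
  filter_upwards [self_mem_nhdsWithin] with t ht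
  rw [ouLaplaceDensity, max_eq_left (le_of_lt ht)]

/-- The resolvent maps into `D(L)`, and `L R φ = l R φ - φ`. -/
lemma isOUGen_resolvent (h : OUSetting S Q ω) {l : ℝ} (hl : 0 < l) (φ : Cb H) :
    IsOUGen S Q (h.resolvent hl φ) (l • h.resolvent hl φ - φ) := by
  constructor
  · intro x
    set J := h.resolvent hl φ x with hJ
    have hG : HasDerivWithinAt (fun s => ∫ t in (0 : ℝ)..s, ouLaplaceDensity S Q l φ t x) (φ x)
        (Ici 0) 0 :=
      intervalIntegral.integral_hasDerivWithinAt_of_tendsto_ae_right (t := Ioi 0)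
        IntervalIntegrable.refl
        (h.measurable_ouLaplaceDensity l φ x).stronglyMeasurable.stronglyMeasurableAtFilter
        ((h.tendsto_ouLaplaceDensity_zero l φ x).mono_left inf_le_left)
    have hE : HasDerivWithinAt (fun s : ℝ => Real.exp (l * s)) l (Ici 0) 0 := by
      have := (((hasDerivAt_id (0 : ℝ)).const_mul l).exp).hasDerivWithinAt (s := Ici 0)
      simpa using this
    have hD := hE.mul ((hasDerivWithinAt_const (0 : ℝ) (Ici 0) J).sub hG)
    have hT := (hasDerivWithinAt_iff_tendsto_slope.1 hD).mono_left
      (nhdsWithin_mono 0 (t := Ici (0 : ℝ) \ {0}) (s := Ioi 0) fun t ht =>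
        ⟨le_of_lt ht, ne_of_gt ht⟩)
    have e : (l • h.resolvent hl φ - φ : Cb H) x = l * J - φ x := rfl
    rw [e]
    convert hT.congr' ?_ using 2
    · simp; ring
    · filter_upwards [self_mem_nhdsWithin] with s hs
      rw [h.ouSemigroup_resolvent hl φ (le_of_lt hs), slope_def_field]
      simp [hJ]
  · refine ⟨2 * Real.exp l * ‖φ‖, fun t ht x => ?_⟩
    have ht0 := ht.1
    rw [h.ouSemigroup_resolvent hl φ ht.1.le, abs_div, abs_of_pos ht.1, div_le_iff₀ ht.1]
    have hJ : |h.resolvent hl φ x| ≤ l⁻¹ * ‖φ‖ := h.abs_integral_ouLaplaceDensity_le hl φ x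
    have hI : |∫ s in (0 : ℝ)..t, ouLaplaceDensity S Q l φ s x| ≤ ‖φ‖ * t := by
      have := intervalIntegral.norm_integral_le_of_norm_le_const (a := 0) (b := t) (C := ‖φ‖)
        (f := fun s => ouLaplaceDensity S Q l φ s x) fun s hs => by
          rw [uIoc_of_le ht.1.le] at hs
          refine (h.abs_ouLaplaceDensity_le l φ s x).trans ?_
          have h3 : Real.exp (-l * s) ≤ 1 := by
            rw [Real.exp_le_one_iff]
            nlinarith [hs.1]
          exact mul_le_of_le_one_left (norm_nonneg _) h3
      simpa [abs_of_pos ht.1] using this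
    have hE1 : Real.exp (l * t) ≤ Real.exp l := by
      rw [Real.exp_le_exp]
      nlinarith [ht.2]
    have hE2 : Real.exp (l * t) - 1 ≤ l * t * Real.exp l := by
      have h4 := Real.add_one_le_exp (-(l * t))
      have h5 : Real.exp (l * t) * Real.exp (-(l * t)) = 1 := by
        rw [← Real.exp_add, add_neg_cancel, Real.exp_zero]
      have h6 : l * t * Real.exp (l * t) ≤ l * t * Real.exp l := by gcongr
      nlinarith [Real.exp_pos (l * t)]
    have hE3 : 0 ≤ Real.exp (l * t) - 1 := by
      rw [sub_nonneg, Real.one_le_exp_iff]; positivity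
    calc _ = |(Real.exp (l * t) - 1) * h.resolvent hl φ x -
          Real.exp (l * t) * ∫ s in (0 : ℝ)..t, ouLaplaceDensity S Q l φ s x| := by
          congr 1; ring
      _ ≤ (Real.exp (l * t) - 1) * |h.resolvent hl φ x| +
          Real.exp (l * t) * |∫ s in (0 : ℝ)..t, ouLaplaceDensity S Q l φ s x| := by
          refine (abs_sub _ _).trans_eq ?_
          rw [abs_mul, abs_mul, abs_of_nonneg hE3, abs_of_pos (Real.exp_pos _)]
      _ ≤ (l * t * Real.exp l) * (l⁻¹ * ‖φ‖) + Real.exp l * (‖φ‖ * t) := by gcongr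
      _ = 2 * Real.exp l * ‖φ‖ * t := by field_simp; ring

/-- For `φ ∈ D(L)`, the function `t ↦ R_t φ(x)` is locally Lipschitz continuous. -/
lemma abs_ouSemigroup_sub_le_of_isOUGen (h : OUSetting S Q ω) {φ : Cb H} {C : ℝ}
    (hC : ∀ t ∈ Ioo (0 : ℝ) 1, ∀ x : H, |(ouSemigroup S Q t φ x - φ x) / t| ≤ C) {s t : ℝ}
    (hs : 0 ≤ s) (hst : s ≤ t) (hst1 : t - s < 1) (x : H) :
    |ouSemigroup S Q t φ x - ouSemigroup S Q s φ x| ≤ C * (t - s) := by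
  rcases hst.eq_or_lt with rfl | hst
  · simp
  have hd : 0 < t - s := sub_pos.2 hst
  have h1 := h.ouSemigroup_add_time hd.le hs φ x
  rw [sub_add_cancel] at h1
  have h2 : ouSemigroup S Q s (ouCb S Q (t - s) φ) x - ouSemigroup S Q s φ x =
      ∫ y, (ouSemigroup S Q (t - s) φ (S s x + y) - φ (S s x + y)) ∂(gaussian (covOp S Q s)) :=
    (integral_sub (integrable_shift (ouCb S Q (t - s) φ) _ _) (integrable_shift φ _ _)).symm
  rw [h1, h2]
  refine h.abs_integral_le hs fun y => ?_
  have h3 := hC (t - s) ⟨hd, hst1⟩ (S s x + y)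
  rwa [abs_div, abs_of_pos hd, div_le_iff₀ hd] at h3

/-- For `φ ∈ D(L)`, the right derivative of `t ↦ R_t φ(x)` is `R_t L φ(x)`. -/
lemma hasDerivWithinAt_ouSemigroup (h : OUSetting S Q ω) {φ g : Cb H} (hφ : IsOUGen S Q φ g)
    {t : ℝ} (ht : 0 ≤ t) (x : H) :
    HasDerivWithinAt (fun s => ouSemigroup S Q s φ x) (ouSemigroup S Q t g x) (Ioi t) t := by
  obtain ⟨h1, C, hC⟩ := hφ
  have h2 : Tendsto (fun s => ∫ y, (ouSemigroup S Q s φ (S t x + y) - φ (S t x + y)) / s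
      ∂(gaussian (covOp S Q t))) (𝓝[>] 0) (𝓝 (ouSemigroup S Q t g x)) := by
    refine tendsto_integral_filter_of_dominated_convergence (fun _ => C)
      (Eventually.of_forall fun s => (((integrable_shift (ouCb S Q s φ) _ _).sub
        (integrable_shift φ _ _)).div_const s).1) ?_ (integrable_const _)
      (Eventually.of_forall fun y => h1 _)
    filter_upwards [Ioo_mem_nhdsGT one_pos] with s hs
    exact Eventually.of_forall fun y => hC s hs _
  have h3 : Tendsto (fun s => s - t) (𝓝[>] t) (𝓝[>] 0) := by
    refine tendsto_nhdsWithin_iff.2 ⟨?_, ?_⟩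
    · have : Continuous fun s : ℝ => s - t := by fun_prop
      simpa using (this.tendsto t).mono_left nhdsWithin_le_nhds
    · filter_upwards [self_mem_nhdsWithin] with s hs
      exact sub_pos.2 (mem_Ioi.1 hs)
  rw [hasDerivWithinAt_iff_tendsto_slope, sdiff_singleton_eq_self (by simp)]
  refine (h2.comp h3).congr' ?_
  filter_upwards [self_mem_nhdsWithin] with s hs
  have hs' : 0 < s - t := sub_pos.2 (mem_Ioi.1 hs)
  have h4 := h.ouSemigroup_add_time hs'.le ht φ x
  rw [sub_add_cancel] at h4
  rw [Function.comp, slope_def_field, h4, integral_div]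
  congr 1
  exact integral_sub (integrable_shift (ouCb S Q (s - t) φ) _ _) (integrable_shift φ _ _)

/-- The resolvent is a left inverse of `l - L`: integrate the derivative of `e^{-lt} R_t φ(x)`. -/
lemma resolvent_of_isOUGen (h : OUSetting S Q ω) {l : ℝ} (hl : 0 < l) {φ g : Cb H}
    (hφ : IsOUGen S Q φ g) : h.resolvent hl (l • φ - g) = φ := by
  refine Cb.ext fun x => ?_
  set u : ℝ → ℝ := fun t => Real.exp (-l * t) * ouSemigroup S Q t φ x with hu
  set d : ℝ → ℝ := fun t => -ouLaplaceDensity S Q l (l • φ - g) t x with hd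
  have hsub : ∀ t, ouSemigroup S Q t (l • φ - g) x =
      l * ouSemigroup S Q t φ x - ouSemigroup S Q t g x := fun t => by
    rw [show l • φ - g = l • φ + (-1 : ℝ) • g by module, ouSemigroup_add, ouSemigroup_smul,
      ouSemigroup_smul]
    ring
  have hi := h.integrableOn_ouLaplaceDensity hl (l • φ - g) x
  have hcont : ContinuousOn (fun t => ouSemigroup S Q t φ x) (Ici 0) := by
    obtain ⟨-, C, hC⟩ := hφ
    intro t ht
    have key : ∀ᶠ s in 𝓝[Ici 0] t,
        ‖ouSemigroup S Q s φ x - ouSemigroup S Q t φ x‖ ≤ C * |s - t| := by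
      filter_upwards [self_mem_nhdsWithin, nhdsWithin_le_nhds (Metric.ball_mem_nhds t one_pos)]
        with s hs hst
      rw [Metric.mem_ball, Real.dist_eq] at hst
      rw [Real.norm_eq_abs]
      rcases le_total s t with hle | hle
      · rw [abs_sub_comm s t, abs_of_nonneg (sub_nonneg.2 hle)] at *
        rw [abs_sub_comm]
        exact h.abs_ouSemigroup_sub_le_of_isOUGen hC hs hle hst x
      · rw [abs_of_nonneg (sub_nonneg.2 hle)] at *
        exact h.abs_ouSemigroup_sub_le_of_isOUGen hC ht hle hst x
    rw [ContinuousWithinAt, tendsto_iff_norm_sub_tendsto_zero]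
    refine squeeze_zero' (Eventually.of_forall fun _ => norm_nonneg _) key ?_
    have : Continuous fun s : ℝ => C * |s - t| := by fun_prop
    simpa using (this.tendsto t).mono_left nhdsWithin_le_nhds
  have hftc : ∀ T, 0 ≤ T → ∫ t in (0 : ℝ)..T, d t = u T - φ x := by
    intro T hT
    have hu0 : u 0 = φ x := by simp [hu, h.ouSemigroup_zero_time]
    rw [← hu0]
    refine intervalIntegral.integral_eq_sub_of_hasDeriv_right_of_le hT ?_ (fun t ht => ?_) ?_
    · exact (Continuous.continuousOn (by fun_prop)).mul (hcont.mono Icc_subset_Ici_self)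
    · have hE : HasDerivWithinAt (fun s : ℝ => Real.exp (-l * s)) (Real.exp (-l * t) * (-l))
          (Ioi t) t := by
        have := (((hasDerivAt_id t).const_mul (-l)).exp).hasDerivWithinAt (s := Ioi t)
        simpa using this
      refine (hE.mul (h.hasDerivWithinAt_ouSemigroup hφ ht.1.le x)).congr_deriv ?_
      simp only [hd, ouLaplaceDensity, hsub, max_eq_left ht.1.le]
      ring
    · rw [intervalIntegrable_iff_integrableOn_Ioc_of_le hT]
      exact (hi.mono_set Ioc_subset_Ioi_self).neg
  have h1 : Tendsto (fun T => ∫ t in (0 : ℝ)..T, d t) atTop (𝓝 (∫ t in Ioi 0, d t)) :=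
    intervalIntegral_tendsto_integral_Ioi 0 hi.neg tendsto_id
  have h2 : Tendsto (fun T => u T - φ x) atTop (𝓝 (0 - φ x)) := by
    refine Tendsto.sub_const ?_ _
    have h3 : Tendsto (fun T : ℝ => Real.exp (-l * T) * ‖φ‖) atTop (𝓝 (0 * ‖φ‖)) := by
      refine Tendsto.mul_const _ (Real.tendsto_exp_atBot.comp ?_)
      exact tendsto_id.const_mul_atTop_of_neg (neg_lt_zero.2 hl)
    rw [zero_mul] at h3
    refine squeeze_zero_norm' ?_ h3
    filter_upwards [eventually_ge_atTop 0] with T hT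
    rw [hu, norm_mul, Real.norm_of_nonneg (Real.exp_pos _).le]
    gcongr
    exact h.abs_ouSemigroup_le hT φ x
  have h3 := tendsto_nhds_unique (h1.congr' (by
    filter_upwards [eventually_ge_atTop 0] with T hT using hftc T hT)) h2
  rw [hd, integral_neg] at h3
  rw [resolvent_apply]
  linarith

end OUSetting

end Resolvent

/-! ### Sums of series in `C_b^1(H)` -/

/-- Evaluation at a point, as a continuous linear functional on `C_b(H)`. -/
def Cb.evalCLM (x : H) : Cb H →L[ℝ] ℝ :=
  LinearMap.mkContinuous
    { toFun := fun φ => φ x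
      map_add' := fun φ ψ => φ.add_apply ψ x
      map_smul' := fun c φ => φ.smul_apply c x }
    1 fun φ => (φ.abs_le_norm x).trans_eq (one_mul _).symm

lemma abs_sub_le_of_hasSum {v : ℕ → Cb H} {φ : Cb H} (hv : HasSum v φ) {b : ℕ → ℝ} {B : ℝ}
    (hb : HasSum b B) (h1 : ∀ i, v i ∈ Cb1 H) (h2 : ∀ i, gradNorm (v i) ≤ b i) (x y : H) :
    |φ x - φ y| ≤ B * ‖x - y‖ := by
  have h3 : HasSum (fun i => v i x - v i y) (φ x - φ y) :=
    (hv.mapL (Cb.evalCLM x)).sub (hv.mapL (Cb.evalCLM y))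
  refine h3.norm_le_of_bounded (hb.mul_right ‖x - y‖) fun i => ?_
  exact (abs_sub_le_gradNorm (h1 i) x y).trans (by gcongr; exact h2 i)

/-- A series converging in `C_b(H)` whose differentials are absolutely summable converges in
`C_b^1(H)`. -/
lemma mem_Cb1_of_hasSum {v : ℕ → Cb H} {φ : Cb H} (hv : HasSum v φ) {b : ℕ → ℝ} {B : ℝ}
    (hb : HasSum b B) (h1 : ∀ i, v i ∈ Cb1 H) (h2 : ∀ i, gradNorm (v i) ≤ b i) :
    φ ∈ Cb1 H ∧ gradNorm φ ≤ B := by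
  refine ⟨mem_Cb1_iff.2 (HasUnifIncr.of_forall_approx fun δ hδ => ?_), gradNorm_le ?_
    (abs_sub_le_of_hasSum hv hb h1 h2)⟩
  · have h3 : ∀ᶠ n in atTop, B - ∑ i ∈ Finset.range n, b i < δ := by
      have := hb.tendsto_sum_nat.const_sub B
      rw [sub_self] at this
      exact this.eventually_lt_const hδ
    obtain ⟨n, hn⟩ := h3.exists
    refine ⟨(∑ i ∈ Finset.range n, v i : Cb H),
      mem_Cb1_iff.1 (Submodule.sum_mem _ fun i _ => h1 i), fun x y => ?_⟩
    refine (abs_sub_le_of_hasSum ((hasSum_nat_add_iff' n).2 hv) ((hasSum_nat_add_iff' n).2 hb)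
      (fun i => h1 _) (fun i => h2 _) x y).trans ?_
    gcongr
  · exact hb.nonneg fun i => (gradNorm_nonneg _).trans (h2 i)

/-! ### The Ornstein-Uhlenbeck resolvent on `C_b^1(H)` -/

section ResolventCb1

variable [CompleteSpace H] [MeasurableSpace H] [BorelSpace H]
  [TopologicalSpace.SeparableSpace H] {S : ℝ → H →L[ℝ] H} {Q : H →L[ℝ] H} {ω : ℝ}

lemma integral_sub_sub_add {α : Type*} [MeasurableSpace α] {μ : Measure α} {a b c d : α → ℝ}
    (ha : Integrable a μ) (hb : Integrable b μ) (hc : Integrable c μ) (hd : Integrable d μ) :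
    ∫ x, a x ∂μ - ∫ x, b x ∂μ - ∫ x, c x ∂μ + ∫ x, d x ∂μ =
      ∫ x, (a x - b x - c x + d x) ∂μ := by
  rw [integral_add (f := fun x => a x - b x - c x) ((ha.sub hb).sub hc) hd,
    integral_sub (f := fun x => a x - b x) (ha.sub hb) hc, integral_sub ha hb]

namespace OUSetting

lemma norm_apply_le (h : OUSetting S Q ω) {t : ℝ} (ht : 0 ≤ t) (x : H) :
    ‖S t x‖ ≤ Real.exp (ω * t) * ‖x‖ :=
  ((S t).le_opNorm x).trans (by gcongr; exact h.norm_le t ht)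

lemma abs_ouSemigroup_sub_le_exp (h : OUSetting S Q ω) {f : Cb H} {L : ℝ} (hL : 0 ≤ L)
    (hf : ∀ x y, |f x - f y| ≤ L * ‖x - y‖) {t : ℝ} (ht : 0 ≤ t) (x y : H) :
    |ouSemigroup S Q t f x - ouSemigroup S Q t f y| ≤ L * (Real.exp (ω * t) * ‖x - y‖) := by
  rw [ouSemigroup, ouSemigroup, ← integral_sub (integrable_shift f _ _) (integrable_shift f _ _)]
  refine h.abs_integral_le ht fun z => (hf _ _).trans ?_
  gcongr
  rw [add_sub_add_right_eq_sub, ← map_sub]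
  exact h.norm_apply_le ht _

/-- The mixed differences of `R_t f` inherit a bound from those of `f`. -/
lemma abs_ouSemigroup_mixed_le (h : OUSetting S Q ω) {f : Cb H} {m : ℝ → ℝ}
    (hm0 : ∀ κ, 0 ≤ κ → 0 ≤ m κ) (hm : Monotone m)
    (hf : ∀ x h k, |f (x + h + k) - f (x + h) - f (x + k) + f x| ≤ m ‖k‖ * ‖h‖) {t : ℝ}
    (ht : 0 ≤ t) (x v k : H) :
    |ouSemigroup S Q t f (x + v + k) - ouSemigroup S Q t f (x + v) - ouSemigroup S Q t f (x + k) +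
      ouSemigroup S Q t f x| ≤ m (Real.exp (ω * t) * ‖k‖) * (Real.exp (ω * t) * ‖v‖) := by
  simp only [ouSemigroup]
  rw [integral_sub_sub_add (integrable_shift f _ _) (integrable_shift f _ _)
    (integrable_shift f _ _) (integrable_shift f _ _)]
  refine h.abs_integral_le ht fun z => ?_
  have h1 := hf (S t x + z) (S t v) (S t k)
  have e1 : S t (x + v + k) + z = S t x + z + S t v + S t k := by simp only [map_add]; abel
  have e2 : S t (x + v) + z = S t x + z + S t v := by simp only [map_add]; abel
  have e3 : S t (x + k) + z = S t x + z + S t k := by simp only [map_add]; abel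
  rw [e1, e2, e3]
  refine h1.trans ?_
  gcongr
  · exact hm0 _ (by positivity)
  · exact hm (h.norm_apply_le ht k)
  · exact h.norm_apply_le ht v

/-- For `l > ω` the resolvent preserves `C_b^1(H)`. The mixed differences of the Laplace transform
are dominated by an integral that, by dominated convergence, is small for small increments. -/
lemma resolvent_mem_Cb1 (h : OUSetting S Q ω) {l : ℝ} (hl : 0 < l) (hωl : ω < l) {f : Cb H}
    (hf : f ∈ Cb1 H) :
    h.resolvent hl f ∈ Cb1 H ∧ gradNorm (h.resolvent hl f) ≤ gradNorm f / (l - ω) := by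
  have hlω : 0 < l - ω := sub_pos.2 hωl
  set L := gradNorm f with hLdef
  have hL : 0 ≤ L := gradNorm_nonneg f
  have hlip := abs_sub_le_gradNorm hf
  have hexp : ∀ t, Real.exp (-l * t) * Real.exp (ω * t) = Real.exp (-(l - ω) * t) := fun t => by
    rw [← Real.exp_add]; congr 1; ring
  have hint : IntegrableOn (fun t => Real.exp (-(l - ω) * t)) (Ioi 0) :=
    integrableOn_exp_mul_Ioi (neg_lt_zero.2 hlω) 0
  have hval : ∫ t in Ioi (0 : ℝ), Real.exp (-(l - ω) * t) = (l - ω)⁻¹ := by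
    rw [integral_exp_mul_Ioi (neg_lt_zero.2 hlω)]
    rw [mul_zero, Real.exp_zero, neg_div_neg_eq, one_div]
  have hi := fun x => h.integrableOn_ouLaplaceDensity hl f x
  constructor
  · rw [mem_Cb1_iff]
    intro δ hδ
    obtain ⟨r, hr, hr1⟩ := (mem_Cb1_iff.1 hf) (δ * (l - ω) / 2) (by positivity)
    set δ' := δ * (l - ω) / 2 with hδ'
    have hδ'0 : 0 ≤ δ' := by positivity
    -- `m ‖k‖ * ‖h‖` bounds the mixed differences of `f` for all `k`, not only for `‖k‖ ≤ r`, as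
    -- `e^{tA} k` may grow with `t`
    let m : ℝ → ℝ := fun κ => min (2 * L) (δ' + 2 * L / r * κ)
    have hmm : Monotone m := fun a b hab => min_le_min_left _ (by gcongr)
    have hm0 : ∀ κ, 0 ≤ κ → 0 ≤ m κ := fun κ hκ => le_min (by positivity) (by positivity)
    have hfm : ∀ x v k, |f (x + v + k) - f (x + v) - f (x + k) + f x| ≤ m ‖k‖ * ‖v‖ := by
      intro x v k
      have h1 : |f (x + v + k) - f (x + v) - f (x + k) + f x| ≤ 2 * L * ‖v‖ := by
        have h2 := hlip (x + v + k) (x + k)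
        have h3 := hlip x (x + v)
        rw [show x + v + k - (x + k) = v by abel] at h2
        rw [show x - (x + v) = -v by abel, norm_neg] at h3
        calc _ = |(f (x + v + k) - f (x + k)) + (f x - f (x + v))| := by congr 1; ring
          _ ≤ _ := (abs_add_le _ _).trans (by linarith)
      rw [min_mul_of_nonneg _ _ (norm_nonneg v)]
      refine le_min h1 ?_
      rcases le_total ‖k‖ r with hk | hk
      · refine (hr1 x v k hk).trans ?_
        gcongr
        exact le_add_of_nonneg_right (by positivity)
      · refine h1.trans ?_
        gcongr
        have : 2 * L ≤ 2 * L / r * ‖k‖ := by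
          rw [div_mul_eq_mul_div, le_div_iff₀ hr]
          gcongr
        linarith
    let Φ : ℝ → ℝ := fun κ =>
      ∫ t in Ioi (0 : ℝ), Real.exp (-(l - ω) * t) * m (Real.exp (ω * t) * |κ|)
    have hmeas : ∀ κ, AEStronglyMeasurable
        (fun t => Real.exp (-(l - ω) * t) * m (Real.exp (ω * t) * |κ|))
        (volume.restrict (Ioi 0)) := fun κ =>
      (by fun_prop : Continuous fun t => Real.exp (-(l - ω) * t) *
        m (Real.exp (ω * t) * |κ|)).aestronglyMeasurable
    have hbd : ∀ κ t, ‖Real.exp (-(l - ω) * t) * m (Real.exp (ω * t) * |κ|)‖ ≤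
        Real.exp (-(l - ω) * t) * (2 * L) := by
      intro κ t
      rw [Real.norm_of_nonneg (mul_nonneg (Real.exp_pos _).le (hm0 _ (by positivity)))]
      gcongr
      exact min_le_left _ _
    have hΦ : Tendsto Φ (𝓝 0) (𝓝 (Φ 0)) := by
      refine tendsto_integral_filter_of_dominated_convergence _
        (Eventually.of_forall hmeas)
        (Eventually.of_forall fun κ => Eventually.of_forall fun t => hbd κ t)
        (hint.mul_const (2 * L)) (Eventually.of_forall fun t => ?_)
      exact (by fun_prop : Continuous fun κ => Real.exp (-(l - ω) * t) *
        m (Real.exp (ω * t) * |κ|)).tendsto 0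
    have hΦ0 : Φ 0 < δ := by
      have h1 : Φ 0 ≤ (l - ω)⁻¹ * δ' := by
        rw [← hval, ← integral_mul_const]
        refine setIntegral_mono ((hint.mul_const (2 * L)).mono' (hmeas 0)
          (Eventually.of_forall fun t => hbd 0 t)) (hint.mul_const _) fun t => ?_
        gcongr
        simp [m]
      refine h1.trans_lt ?_
      rw [hδ']
      field_simp
      linarith
    obtain ⟨ρ, hρ, hρ1⟩ := Metric.eventually_nhds_iff.1 (hΦ.eventually_lt_const hΦ0)
    refine ⟨ρ / 2, by positivity, fun x v k hk => ?_⟩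
    have hk1 : Φ ‖k‖ ≤ δ := by
      refine (hρ1 ?_).le
      rw [dist_zero_right, norm_norm]
      linarith
    simp only [resolvent_apply]
    rw [integral_sub_sub_add (hi _) (hi _) (hi _) (hi _)]
    refine le_trans (norm_integral_le_of_norm_le (g := fun t => Real.exp (-(l - ω) * t) *
      m (Real.exp (ω * t) * |‖k‖|) * ‖v‖) ?_ ?_) (mul_le_mul_of_nonneg_right hk1 (norm_nonneg v)
        |>.trans' (integral_mul_const _ _).le)
    · exact ((hint.mul_const (2 * L)).mono' (hmeas _)
          (Eventually.of_forall fun t => hbd _ t)).mul_const _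
    · refine (ae_restrict_iff' measurableSet_Ioi).2 (Eventually.of_forall fun t ht => ?_)
      have ht : 0 < t := ht
      simp only [ouLaplaceDensity]
      rw [max_eq_left ht.le, ← mul_sub, ← mul_sub, ← mul_add, Real.norm_eq_abs,
        abs_mul, abs_of_pos (Real.exp_pos _), ← hexp, abs_norm]
      refine (mul_le_mul_of_nonneg_left (h.abs_ouSemigroup_mixed_le hm0 hmm hfm ht.le x v k)
        (Real.exp_pos _).le).trans_eq ?_
      ring
  · refine gradNorm_le (by positivity) fun x y => ?_
    rw [resolvent_apply, resolvent_apply, ← integral_sub (hi x) (hi y)]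
    rw [← Real.norm_eq_abs]
    refine (norm_integral_le_of_norm_le (hint.mul_const (L * ‖x - y‖)) ?_).trans_eq ?_
    · refine (ae_restrict_iff' measurableSet_Ioi).2 (Eventually.of_forall fun t ht => ?_)
      have ht : 0 < t := ht
      rw [ouLaplaceDensity, ouLaplaceDensity, max_eq_left ht.le, ← mul_sub, Real.norm_eq_abs,
        abs_mul, abs_of_pos (Real.exp_pos _), ← hexp]
      refine (mul_le_mul_of_nonneg_left (h.abs_ouSemigroup_sub_le_exp hL hlip ht.le x y)
        (Real.exp_pos _).le).trans_eq ?_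
      ring
    · rw [integral_mul_const, hval]; ring

end OUSetting

end ResolventCb1

/-! ### Operators with resolvents -/

section Abstract

variable {X : Type*} [NormedAddCommGroup X] [NormedSpace ℝ X]

lemma IsResolvent.sub_eq_of_eq {N : X →ₗ.[ℝ] X} {l : ℝ} {R : X →L[ℝ] X} (hR : IsResolvent N l R)
    {f φ : X} (hφ : φ = R f) : ∃ h : φ ∈ N.domain, l • φ - N ⟨φ, h⟩ = f := by
  subst hφ
  exact hR.1 f

/-- Bounded perturbation of a resolvent: if `1 - R B` is invertible, then `(1 - R B)⁻¹ R` is the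
resolvent of `N + B`, written here for `N' = N + c B - c` with the parameter shifted by `c`. -/
lemma IsResolvent.perturb {N N' : X →ₗ.[ℝ] X} {l c : ℝ} {R B : X →L[ℝ] X}
    (hR : IsResolvent N (l + c) R) (hdom : N'.domain = N.domain)
    (hN' : ∀ φ (h : φ ∈ N.domain) (h' : φ ∈ N'.domain),
      N' ⟨φ, h'⟩ = N ⟨φ, h⟩ + (B φ - c • φ))
    (hu : IsUnit (1 - R.comp B)) :
    IsResolvent N' l ((Ring.inverse (1 - R.comp B)).comp R) := by
  set T := R.comp B with hT
  set G := Ring.inverse (1 - T) with hG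
  have h1 : ∀ ψ : X, G (ψ - T ψ) = ψ := fun ψ =>
    DFunLike.congr_fun (Ring.inverse_mul_cancel _ hu) ψ
  have h2 : ∀ ψ : X, G ψ - T (G ψ) = ψ := fun ψ =>
    DFunLike.congr_fun (Ring.mul_inverse_cancel _ hu) ψ
  refine ⟨fun f => ?_, fun φ => ?_⟩
  · have h3 : G (R f) = R (f + B (G (R f))) := by
      rw [map_add, ← sub_eq_iff_eq_add]
      exact h2 (R f)
    set φ := G (R f) with hφ
    obtain ⟨h6, h7⟩ := hR.sub_eq_of_eq h3
    have h8 : φ ∈ N'.domain := hdom ▸ h6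
    refine ⟨h8, ?_⟩
    change l • φ - N' ⟨φ, h8⟩ = f
    rw [hN' φ h6 h8]
    rw [add_smul] at h7
    have : l • φ - (N ⟨φ, h6⟩ + (B φ - c • φ)) = l • φ + c • φ - N ⟨φ, h6⟩ - B φ := by abel
    rw [this, h7, add_sub_cancel_right]
  · obtain ⟨φ, h'⟩ := φ
    have h6 : φ ∈ N.domain := hdom ▸ h'
    have h7 := hR.2 ⟨φ, h6⟩
    change G (R (l • φ - N' ⟨φ, h'⟩)) = φ
    rw [hN' φ h6 h']
    have e : l • φ - (N ⟨φ, h6⟩ + (B φ - c • φ)) = ((l + c) • φ - N ⟨φ, h6⟩) - B φ := by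
      rw [add_smul]; abel
    rw [e, map_sub, h7]
    exact h1 φ

/-- An operator with a bounded resolvent is closed. -/
lemma IsResolvent.isClosed {N : X →ₗ.[ℝ] X} {l : ℝ} {R : X →L[ℝ] X} (hR : IsResolvent N l R) :
    N.IsClosed := by
  have h : (N.graph : Set (X × X)) = {p | R (l • p.1 - p.2) = p.1} := by
    ext ⟨φ, g⟩
    simp only [SetLike.mem_coe, mem_ofPred_eq, LinearPMap.mem_graph_iff]
    constructor
    · rintro ⟨ψ, rfl, rfl⟩
      exact hR.2 ψ
    · intro hφ
      obtain ⟨h1, h2⟩ := hR.sub_eq_of_eq hφ.symm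
      exact ⟨⟨_, h1⟩, rfl, sub_right_injective h2⟩
  rw [LinearPMap.IsClosed, h]
  exact isClosed_eq (by fun_prop) (by fun_prop)

/-- If a resolvent maps a dense subspace `D` into itself, then `D ∩ D(N)` is a core of `N`. -/
lemma IsResolvent.closure_domRestrict {N : X →ₗ.[ℝ] X} {l : ℝ} {R : X →L[ℝ] X}
    (hR : IsResolvent N l R) {D : Submodule ℝ X} (hD : Dense (D : Set X))
    (hRD : ∀ f ∈ D, R f ∈ D) :
    (N.domRestrict D).IsClosable ∧ (N.domRestrict D).closure = N := by
  have hle : N.domRestrict D ≤ N := LinearPMap.domRestrict_le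
  have hc := hR.isClosed.isClosable.leIsClosable hle
  refine ⟨hc, LinearPMap.eq_of_eq_graph ?_⟩
  rw [← hc.graph_closure_eq_closure_graph]
  refine le_antisymm (Submodule.topologicalClosure_minimal _
    (LinearPMap.le_graph_of_le hle) hR.isClosed) ?_
  rintro ⟨φ, g⟩ hφ
  rw [LinearPMap.mem_graph_iff] at hφ
  obtain ⟨ψ, rfl, rfl⟩ := hφ
  have h1 : ((ψ : X), N ψ) =
      (R (l • (ψ : X) - N ψ), l • R (l • (ψ : X) - N ψ) - (l • (ψ : X) - N ψ)) := by
    rw [hR.2 ψ, sub_sub_cancel]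
  rw [h1]
  refine map_mem_closure (f := fun f => (R f, l • R f - f)) (by fun_prop)
    (hD (l • (ψ : X) - N ψ)) ?_
  intro f hf
  obtain ⟨h2, h3⟩ := hR.1 f
  refine (LinearPMap.mem_graph_iff _).2 ⟨⟨R f, hRD f hf, h2⟩, rfl, ?_⟩
  refine (LinearPMap.domRestrict_apply (y := ⟨R f, h2⟩) rfl).trans ?_
  exact (sub_eq_of_eq_add' (sub_eq_iff_eq_add.1 h3)).symm

/-- If `(l + c) ‖(l + c - N)⁻¹‖ ≤ 1` and `‖B‖ ≤ c`, then `N' = N + B - c` satisfies the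
dissipativity estimate with the parameter `l`. -/
lemma IsResolvent.dissipative_perturb {N N' : X →ₗ.[ℝ] X} {l c : ℝ} {R B : X →L[ℝ] X}
    (hR : IsResolvent N (l + c) R) (hdom : N'.domain = N.domain)
    (hN' : ∀ φ (h : φ ∈ N.domain) (h' : φ ∈ N'.domain),
      N' ⟨φ, h'⟩ = N ⟨φ, h⟩ + (B φ - c • φ))
    (hlc : 0 < l + c) (hR1 : ‖R‖ ≤ (l + c)⁻¹) (hB : ‖B‖ ≤ c) (φ : N'.domain) :
    l * ‖(φ : X)‖ ≤ ‖l • (φ : X) - N' φ‖ := by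
  obtain ⟨φ, h'⟩ := φ
  have h6 : φ ∈ N.domain := hdom ▸ h'
  have h7 : R ((l + c) • φ - N ⟨φ, h6⟩) = φ := hR.2 ⟨φ, h6⟩
  have e : (l + c) • φ - N ⟨φ, h6⟩ = (l • φ - N' ⟨φ, h'⟩) + B φ := by
    rw [hN' φ h6 h', add_smul]; abel
  rw [e] at h7
  have h8 : ‖φ‖ ≤ (l + c)⁻¹ * (‖l • φ - N' ⟨φ, h'⟩‖ + c * ‖φ‖) := by
    calc ‖φ‖ = ‖R ((l • φ - N' ⟨φ, h'⟩) + B φ)‖ := by rw [h7]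
      _ ≤ ‖R‖ * ‖(l • φ - N' ⟨φ, h'⟩) + B φ‖ := R.le_opNorm _
      _ ≤ (l + c)⁻¹ * (‖l • φ - N' ⟨φ, h'⟩‖ + c * ‖φ‖) := by
        gcongr
        exact (norm_add_le _ _).trans (by gcongr; exact B.le_of_opNorm_le hB φ)
  rw [inv_mul_eq_div, le_div_iff₀ hlc] at h8
  change l * ‖φ‖ ≤ ‖l • φ - N' ⟨φ, h'⟩‖
  linarith

lemma IsDissipative.domRestrict {N : X →ₗ.[ℝ] X} (hN : IsDissipative N) (D : Submodule ℝ X) :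
    IsDissipative (N.domRestrict D) := fun l hl φ => by
  have e : N.domRestrict D φ = N ⟨φ, φ.2.2⟩ := LinearPMap.domRestrict_apply rfl
  rw [e]
  exact hN l hl ⟨φ, φ.2.2⟩

end Abstract

/-! ### The perturbed Ornstein-Uhlenbeck operator -/

section Perturbed

variable [CompleteSpace H] [MeasurableSpace H] [BorelSpace H]
  [TopologicalSpace.SeparableSpace H] {S : ℝ → H →L[ℝ] H} {Q : H →L[ℝ] H} {ω : ℝ}

lemma gradNorm_smul_le {φ : Cb H} (hφ : φ ∈ Cb1 H) {c : ℝ} (hc : 0 ≤ c) :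
    gradNorm (c • φ) ≤ c * gradNorm φ := by
  refine gradNorm_le (mul_nonneg hc (gradNorm_nonneg φ)) fun x y => ?_
  rw [Cb.smul_apply, Cb.smul_apply, ← mul_sub, abs_mul, abs_of_nonneg hc, mul_assoc]
  gcongr
  exact abs_sub_le_gradNorm hφ x y

lemma dense_Cb1 : Dense (Cb1 H : Set (Cb H)) := fun f => by
  refine Metric.mem_closure_iff.2 fun δ hδ => ?_
  obtain ⟨g, hg, hgf⟩ := exists_mem_Cb1_norm_sub_le f (half_pos hδ)
  refine ⟨g, hg, ?_⟩
  rw [dist_comm, dist_eq_norm]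
  linarith

lemma norm_inv_smul_compOp_le (F : H → H) {ε : ℝ} (hε : 0 < ε) :
    ‖ε⁻¹ • compOp (flow F ε)‖ ≤ 1 / ε := by
  rw [norm_smul, Real.norm_of_nonneg (by positivity), one_div]
  refine mul_le_of_le_one_right (by positivity) (ContinuousLinearMap.opNorm_le_bound _ zero_le_one
    fun φ => ?_)
  rw [one_mul]
  exact norm_compOp_le _ φ

lemma pertOp_apply (F : H → H) (ε : ℝ) (φ : Cb H) (h : φ ∈ (ouOp S Q).domain)
    (h' : φ ∈ (pertOp S Q F ε).domain) :
    pertOp S Q F ε ⟨φ, h'⟩ =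
      ouOp S Q ⟨φ, h⟩ + ((ε⁻¹ • compOp (flow F ε)) φ - (1 / ε) • φ) := by
  change ouOp S Q ⟨φ, h⟩ + ε⁻¹ • (compOp (flow F ε) φ - φ) = _
  rw [smul_sub, one_div]
  rfl

namespace OUSetting

lemma isResolvent_resolvent (h : OUSetting S Q ω) {l : ℝ} (hl : 0 < l) :
    IsResolvent (ouOp S Q) l (h.resolvent hl) := by
  have hgen : ∀ φ : (ouOp S Q).domain, IsOUGen S Q φ (ouOp S Q φ) := fun φ => φ.2.choose_spec
  refine ⟨fun f => ?_, fun φ => h.resolvent_of_isOUGen hl (hgen φ)⟩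
  have hd : h.resolvent hl f ∈ (ouOp S Q).domain := ⟨_, h.isOUGen_resolvent hl f⟩
  refine ⟨hd, ?_⟩
  rw [(hgen ⟨_, hd⟩).unique (h.isOUGen_resolvent hl f), sub_sub_cancel]

lemma norm_opT_lt_one (h : OUSetting S Q ω) (F : H → H) {ε l : ℝ} (hε : 0 < ε) (hl : 0 < l)
    (hlε : 0 < l + 1 / ε) : ‖opT F ε (h.resolvent hlε)‖ < 1 := by
  calc ‖opT F ε (h.resolvent hlε)‖ ≤ ‖h.resolvent hlε‖ * ‖ε⁻¹ • compOp (flow F ε)‖ :=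
        ContinuousLinearMap.opNorm_comp_le _ _
    _ ≤ (l + 1 / ε)⁻¹ * (1 / ε) := by
        gcongr
        · exact h.norm_resolvent_le hlε
        · exact norm_inv_smul_compOp_le F hε
    _ < 1 := by
        rw [inv_mul_lt_one₀ hlε]
        linarith

/-- The resolvent `(1 - T_l)⁻¹ R(l + 1/ε, L)` of `L + F_ε`. -/
def pertResolvent (h : OUSetting S Q ω) (F : H → H) (ε : ℝ) {l : ℝ} (hlε : 0 < l + 1 / ε) :
    Cb H →L[ℝ] Cb H :=
  (Ring.inverse (1 - opT F ε (h.resolvent hlε))).comp (h.resolvent hlε)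

lemma isResolvent_pertResolvent (h : OUSetting S Q ω) (F : H → H) {ε l : ℝ} (hε : 0 < ε)
    (hl : 0 < l) (hlε : 0 < l + 1 / ε) :
    IsResolvent (pertOp S Q F ε) l (h.pertResolvent F ε hlε) :=
  (h.isResolvent_resolvent hlε).perturb rfl (pertOp_apply F ε)
    (isUnit_one_sub_of_norm_lt_one (h.norm_opT_lt_one F hε hl hlε))

lemma isMDissipative_pertOp (h : OUSetting S Q ω) (F : H → H) {ε : ℝ} (hε : 0 < ε) :
    IsMDissipative (pertOp S Q F ε) := by
  refine ⟨fun l hl φ => ?_, fun l hl f => ?_⟩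
  · have hlε : 0 < l + 1 / ε := by positivity
    exact (h.isResolvent_resolvent hlε).dissipative_perturb (N' := pertOp S Q F ε) rfl
      (pertOp_apply F ε) hlε
      (h.norm_resolvent_le hlε) (norm_inv_smul_compOp_le F hε) φ
  · obtain ⟨h1, h2⟩ := (h.isResolvent_pertResolvent F hε hl (by positivity)).1 f
    exact ⟨⟨_, h1⟩, h2⟩

/-- On `C_b^1(H)`, the operator `T_l` multiplies the seminorm `‖D·‖₀` at most by
`e^{Kε} / (ε (l + 1/ε - ω))`. -/
lemma opT_mem_Cb1 (h : OUSetting S Q ω) {F : H → H} (hF : IsCb1Field F) {K : ℝ}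
    (hK : K = ⨆ x : H, ‖fderiv ℝ F x‖) {ε l : ℝ} (hε : 0 < ε) (hlε : 0 < l + 1 / ε)
    (hωl : ω < l + 1 / ε) {ψ : Cb H} (hψ : ψ ∈ Cb1 H) :
    opT F ε (h.resolvent hlε) ψ ∈ Cb1 H ∧
      gradNorm (opT F ε (h.resolvent hlε) ψ) ≤
        ε⁻¹ * Real.exp (K * ε) / (l + 1 / ε - ω) * gradNorm ψ := by
  have hωl' : 0 < l + 1 / ε - ω := sub_pos.2 hωl
  obtain ⟨h1, h2⟩ := hF.compOp_flow_mem_Cb1 hK hε.le hψ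
  obtain ⟨h3, h4⟩ := h.resolvent_mem_Cb1 hlε hωl ((Cb1 H).smul_mem ε⁻¹ h1)
  refine ⟨h3, h4.trans ?_⟩
  rw [div_mul_eq_mul_div]
  gcongr
  refine (gradNorm_smul_le h1 (by positivity)).trans ?_
  rw [mul_assoc]
  gcongr

/-- The Neumann series of `(1 - T_l)⁻¹` converges in `C_b^1(H)`. -/
lemma pertResolvent_mem_Cb1 (h : OUSetting S Q ω) {F : H → H} (hF : IsCb1Field F) {K : ℝ}
    (hK : K = ⨆ x : H, ‖fderiv ℝ F x‖) {ε l : ℝ} (hε : 0 < ε) (hl : 0 < l)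
    (hωl : ω + (Real.exp (K * ε) - 1) / ε < l) (hlε : 0 < l + 1 / ε) {f : Cb H} (hf : f ∈ Cb1 H) :
    h.pertResolvent F ε hlε f ∈ Cb1 H ∧
      gradNorm (h.pertResolvent F ε hlε f) ≤
        1 / (l - ω - (Real.exp (K * ε) - 1) / ε) * gradNorm f := by
  set T := opT F ε (h.resolvent hlε) with hT
  set E := Real.exp (K * ε) with hE
  have hE0 : 0 < E := Real.exp_pos _
  set d := l + 1 / ε - ω with hd
  have hdE : ε⁻¹ * E < d := by
    rw [sub_div] at hωl
    rw [hd, inv_mul_eq_div]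
    linarith
  have hd0 : 0 < d := lt_trans (by positivity) hdE
  have hq1 : ε⁻¹ * E / d < 1 := (div_lt_one hd0).2 hdE
  have hsum : HasSum (fun i => (T ^ i) (h.resolvent hlε f)) (h.pertResolvent F ε hlε f) :=
    (hasSum_geom_series_inverse T (h.norm_opT_lt_one F hε hl hlε)).mapL
      (ContinuousLinearMap.apply ℝ (Cb H) (h.resolvent hlε f))
  have hb : HasSum (fun i => (ε⁻¹ * E / d) ^ i * (gradNorm f / d))
      ((1 - ε⁻¹ * E / d)⁻¹ * (gradNorm f / d)) :=
    (hasSum_geometric_of_lt_one (by positivity) hq1).mul_right _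
  have hT1 : ∀ i, (T ^ i) (h.resolvent hlε f) ∈ Cb1 H ∧
      gradNorm ((T ^ i) (h.resolvent hlε f)) ≤ (ε⁻¹ * E / d) ^ i * (gradNorm f / d) := by
    intro i
    induction i with
    | zero =>
      obtain ⟨h1, h2⟩ := h.resolvent_mem_Cb1 hlε (sub_pos.1 hd0) hf
      exact ⟨h1, by rwa [pow_zero, pow_zero, one_mul]⟩
    | succ i ih =>
      obtain ⟨h1, h2⟩ := h.opT_mem_Cb1 hF hK hε hlε (sub_pos.1 hd0) ih.1
      rw [pow_succ']
      refine ⟨h1, h2.trans ?_⟩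
      rw [pow_succ', mul_assoc (ε⁻¹ * E / d)]
      gcongr
      exact ih.2
  obtain ⟨h1, h2⟩ := mem_Cb1_of_hasSum hsum hb (fun i => (hT1 i).1) fun i => (hT1 i).2
  refine ⟨h1, h2.trans_eq ?_⟩
  -- the constant is the sum of the geometric series
  have e : l - ω - (E - 1) / ε = d * (1 - ε⁻¹ * E / d) := by
    rw [mul_sub, mul_div_cancel₀ _ hd0.ne', hd]
    ring
  rw [e, one_div, mul_inv]
  ring

lemma closure_approxOp (h : OUSetting S Q ω) {F : H → H} (hF : IsCb1Field F) {K : ℝ}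
    (hK : K = ⨆ x : H, ‖fderiv ℝ F x‖) {ε : ℝ} (hε : 0 < ε) :
    (approxOp S Q F ε).IsClosable ∧ (approxOp S Q F ε).closure = pertOp S Q F ε := by
  -- any parameter admissible for the gradient estimate serves
  set l := |ω + (Real.exp (K * ε) - 1) / ε| + 1 with hl
  have hl0 : 0 < l := by positivity
  have hl1 : ω + (Real.exp (K * ε) - 1) / ε < l := (le_abs_self _).trans_lt (lt_add_one _)
  have hlε : 0 < l + 1 / ε := by positivity
  exact (h.isResolvent_pertResolvent F hε hl0 hlε).closure_domRestrict dense_Cb1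
    fun f hf => (h.pertResolvent_mem_Cb1 hF hK hε hl0 hl1 hlε hf).1

end OUSetting

end Perturbed

end OUPert

end

theorem proposition3p7 {H : Type*} [NormedAddCommGroup H] [InnerProductSpace ℝ H]
    [CompleteSpace H] [TopologicalSpace.SeparableSpace H] [MeasurableSpace H] [BorelSpace H]
    (A : H →ₗ.[ℝ] H) (S : ℝ → H →L[ℝ] H) (hS : OUPert.IsC0Semigroup S)
    (hA : OUPert.IsGenerator A S)
    (ω : ℝ) (hω : ∀ t : ℝ, 0 ≤ t → ‖S t‖ ≤ Real.exp (ω * t))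
    (Q : H →L[ℝ] H) (hQ : Q.IsPositive)
    (hQt : ∀ t : ℝ, 0 < t → OUPert.IsTraceClass (OUPert.covOp S Q t))
    (F : H → H) (hF : OUPert.IsCb1Field F)
    (K : ℝ) (hK : K = ⨆ x : H, ‖fderiv ℝ F x‖)
    (ε : ℝ) (hε : 0 < ε) :
    -- `N_ε` is dissipative and closable, and its closure is m-dissipative;
    -- the closure is `L + F_ε` on `D(L)`
    (OUPert.IsDissipative (OUPert.approxOp S Q F ε) ∧
      (OUPert.approxOp S Q F ε).IsClosable ∧
      (OUPert.approxOp S Q F ε).closure = OUPert.pertOp S Q F ε ∧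
      OUPert.IsMDissipative (OUPert.approxOp S Q F ε).closure) ∧
    ∀ l : ℝ, 0 < l → ω + (Real.exp (ε * K) - 1) / ε < l →
      ∃ RL : OUPert.Cb H →L[ℝ] OUPert.Cb H,
        OUPert.IsResolvent (OUPert.ouOp S Q) (l + 1 / ε) RL ∧
        IsUnit (1 - OUPert.opT F ε RL) ∧
        ∃ RN : OUPert.Cb H →L[ℝ] OUPert.Cb H,
          RN = (Ring.inverse (1 - OUPert.opT F ε RL)).comp RL ∧
          OUPert.IsResolvent (OUPert.approxOp S Q F ε).closure l RN ∧
          ∀ f ∈ OUPert.Cb1 H,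
            (∃ h : RN f ∈ (OUPert.approxOp S Q F ε).domain,
              l • RN f - OUPert.approxOp S Q F ε ⟨RN f, h⟩ = f) ∧
            RN f ∈ (OUPert.ouOp S Q).domain ∧ RN f ∈ OUPert.Cb1 H ∧
            OUPert.gradNorm (RN f) ≤
              1 / (l - ω - (Real.exp (K * ε) - 1) / ε) * OUPert.gradNorm f := by
  have h : OUPert.OUSetting S Q ω := ⟨hS, hω, hQ, hQt⟩
  obtain ⟨hc, hcl⟩ := h.closure_approxOp hF hK hε
  have hm := h.isMDissipative_pertOp F hε
  rw [hcl]
  refine ⟨⟨hm.1.domRestrict _, hc, rfl, hm⟩, fun l hl hωl => ?_⟩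
  rw [mul_comm ε K] at hωl
  have hlε : 0 < l + 1 / ε := by positivity
  have hR := h.isResolvent_pertResolvent F hε hl hlε
  refine ⟨h.resolvent hlε, h.isResolvent_resolvent hlε,
    isUnit_one_sub_of_norm_lt_one (h.norm_opT_lt_one F hε hl hlε),
    h.pertResolvent F ε hlε, rfl, hR, fun f hf => ?_⟩
  obtain ⟨h1, h2⟩ := hR.1 f
  obtain ⟨h3, h4⟩ := h.pertResolvent_mem_Cb1 hF hK hε hl hωl hlε hf
  exact ⟨⟨⟨h3, h1⟩, h2⟩, h1, h3, h4⟩
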